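/- Let $\sigma(n)$ denote the sum of the positive divisors of $n$ and $\gamma(n)$ the product of the distinct primes dividing $n$; write $p^e\,\|\,n$ if $p^e\mid n$ and $p^{e+1}\nmid n$. **Theorem 1.1.** Let $n\neq 1, 1782$ be a positive integer with $\sigma(n)=\gamma(n)^2$, and suppose that $n$ has the form $$n=2^{e_0}\prod_{i=1}^{s}p_i^{e_i},\qquad (1.1)$$ where $e_0\ge 0$, $p_1,\dots,p_s$ are distinct odd primes and $e_1,\dots,e_s$ are positive integers such that either (a) $s\ge 1$, $p_1\equiv 3\pmod 8$, $e_1=1$ and $e_i$ is even for $2\le i\le s$; or (b) $s\ge 2$, $p_1\equiv p_2\equiv e_1\equiv e_2\equiv 1\pmod 4$, $\min\{e_1,e_2\}=1$ and $e_i$ is even for $3\le i\le s$. Then there exist odd primes $p,p'$ (possibly equal) with $p\,\|\,n$ and $p'\,\|\,n$, an integer $k$ with $0\le k\le 3$, and distinct primes $q_1,\dots,q_k$ (not necessarily odd) with $q_i^2\,\|\,n$ for $1\le i\le k$, such that $$q_1\mid\sigma(p),\qquad q_{i+1}\mid\sigma(q_i^2)\ \ (1\le i\le k-1),\qquad p'\mid\sigma(q_k^2),$$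 where for $k=0$ these conditions are to be read as $p'\mid\sigma(p)$. -/

import Mathlib

/-- `ExactlyDivides p e n` is the relation `p ^ e ∥ n`. -/
def ExactlyDivides (p e n : ℕ) : Prop :=
  p ^ e ∣ n ∧ ¬ p ^ (e + 1) ∣ n

/-- `n = 2 ^ e₀ * ∏_{i = 1}^{s} p_i ^ e_i` with distinct odd primes `p_1, …, p_s` and positive
exponents `e_1, …, e_s`, such that either
(a) `p_1 ≡ 3 (mod 8)`, `e_1 = 1`, and `e_2, …, e_s` are even, or
(b) `p_1 ≡ p_2 ≡ e_1 ≡ e_2 ≡ 1 (mod 4)`, `min (e_1, e_2) = 1`, and `e_3, …, e_s` are even.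
Nothing is required of the exponent `e₀` of `2`. -/
def HasSpecialForm (n : ℕ) : Prop :=
  ∃ (s : ℕ) (p e : ℕ → ℕ),
    n = 2 ^ e 0 * ∏ i ∈ Finset.Icc 1 s, p i ^ e i ∧
    (∀ i ∈ Finset.Icc 1 s, (p i).Prime ∧ Odd (p i) ∧ 0 < e i) ∧
    (∀ i ∈ Finset.Icc 1 s, ∀ j ∈ Finset.Icc 1 s, p i = p j → i = j) ∧
    ((1 ≤ s ∧ p 1 ≡ 3 [MOD 8] ∧ e 1 = 1 ∧ ∀ i ∈ Finset.Icc 2 s, Even (e i)) ∨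
     (2 ≤ s ∧ p 1 ≡ 1 [MOD 4] ∧ p 2 ≡ 1 [MOD 4] ∧ e 1 ≡ 1 [MOD 4] ∧ e 2 ≡ 1 [MOD 4] ∧
        min (e 1) (e 2) = 1 ∧ ∀ i ∈ Finset.Icc 3 s, Even (e i)))

/-!
# Paths between simple primes when `σ(n) = γ(n) ^ 2`

Write `F x = σ(x ^ e)` for `x ^ e ∥ n`, so that `∏ F x = (∏ x) ^ 2` over the primes `x ∣ n`. Call an
odd prime divisor of `n` simple, double or high if its exponent is `1`, `2` or at least `3`; in the
special form the high exponents are at least `4`, and `n` turns out to be even. The paths looked for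
go from a simple prime to a simple prime through odd double primes, each vertex dividing `F` of the
vertex before it.

Suppose a set `S` of double primes is closed: no prime dividing `F x`, with `x` simple or in `S`, is
simple or double outside `S`. The product `A` of these `F x` is then coprime to the squares of the
simple primes and of the double primes outside `S`, hence divides `∏ y ^ 2` over `2`, the high primes
and `S`. With `d` the quotient, the product of the remaining `F x` is `d` times the product of the
remaining squares (`Admissible.exists_cofactor`). The first identity bounds `∏ x ^ 2` over the high
primes from below by about `d / 4` times the product of the simple primes, the second bounds
`∏ x ^ 4` over them from above by `d / F 2` times the square of that product; as the exponents of
high primes are at least `4`, this gives `F 2 * d < 16`, with further factors `F x / x ^ 2` and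
`F x / x ^ 4` to spare on the left (`IsCofactor.bound`). So only `F 2 ∈ {3, 7, 15}` and `d ≤ 5` remain.
They are settled by chasing small prime divisors, using that the prime divisors of `q ^ 2 + q + 1` are
`3` or `≡ 1 (mod 3)` and that no prime divides three of the `F x` (`Admissible.not_dvd_three`). Only
`n = 1782` survives (`IsCofactor.eq_1782`).

For the length of the path, `q ≡ 1 (mod 3)` implies `3 ∣ q ^ 2 + q + 1`, so at most two double primes
are `≡ 1 (mod 3)`, while every vertex of a path after the first double prime is `3` or `≡ 1 (mod 3)`.
If no simple prime is reached within three generations of successors, either these generations form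
a closed set, or a new prime appears in the fourth. In the second case the path to it can only be
`q₁, a, 3, 13` with `a ≡ 1 (mod 3)`, and the same comparison of products, with `3` allowed as an exit
from `S`, gives `3 ∣ d` and `F 2 * d ≤ 92`, hence `F 2 = 7`, which is impossible
(`Admissible.false_of_closed_up_to_three`).
-/

namespace SigmaRadical

/-! ### Local factors of `σ(n)` and the cofactor identity -/

open ArithmeticFunction

/-- The factor `σ(x ^ e)` of `σ(n)` contributed by a prime `x` with `x ^ e ∥ n`. -/
def localSigma (n x : ℕ) : ℕ := sigma 1 (x ^ n.factorization x)

/-- The odd primes `p ∥ n`. -/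
def simplePrimes (n : ℕ) : Finset ℕ :=
  n.primeFactors.filter fun x => x ≠ 2 ∧ n.factorization x = 1

/-- The odd primes `q` with `q ^ 2 ∥ n`. -/
def doublePrimes (n : ℕ) : Finset ℕ :=
  n.primeFactors.filter fun x => x ≠ 2 ∧ n.factorization x = 2

/-- The odd primes whose cube divides `n`. -/
def highPrimes (n : ℕ) : Finset ℕ :=
  n.primeFactors.filter fun x => x ≠ 2 ∧ 3 ≤ n.factorization x

/-- What the argument uses of an `n` of the special form with `σ(n) = γ(n) ^ 2`. In `shape`, the case
of two primes `≡ 1 (mod 4)` with exponents `≡ 1 (mod 4)` is split according to whether both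
exponents are `1`; the residues and parities not needed later are dropped. -/
structure Admissible (n : ℕ) : Prop where
  prod_eq : ∏ x ∈ n.primeFactors, localSigma n x = (∏ x ∈ n.primeFactors, x) ^ 2
  two_mem : 2 ∈ n.primeFactors
  four_le : ∀ x ∈ highPrimes n, 4 ≤ n.factorization x
  residue : ∀ p ∈ simplePrimes n, p % 4 = 1 ∨ p % 8 = 3
  shape : (∃ p, simplePrimes n = {p} ∧ p % 8 = 3 ∧ ∀ x ∈ highPrimes n, Even (n.factorization x)) ∨
    (∃ p p', p ≠ p' ∧ simplePrimes n = {p, p'} ∧ p % 4 = 1 ∧ p' % 4 = 1 ∧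
      ∀ x ∈ highPrimes n, Even (n.factorization x)) ∨
    ∃ p x, simplePrimes n = {p} ∧ x ∈ highPrimes n ∧ 5 ≤ x ∧ 5 ≤ n.factorization x

section Basic

variable {n x q r : ℕ}

lemma mem_simple : x ∈ simplePrimes n ↔
    x ∈ n.primeFactors ∧ x ≠ 2 ∧ n.factorization x = 1 := by simp [simplePrimes]

lemma mem_double : x ∈ doublePrimes n ↔
    x ∈ n.primeFactors ∧ x ≠ 2 ∧ n.factorization x = 2 := by simp [doublePrimes]

lemma mem_high : x ∈ highPrimes n ↔
    x ∈ n.primeFactors ∧ x ≠ 2 ∧ 3 ≤ n.factorization x := by simp [highPrimes]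

lemma prime_of_simple (h : x ∈ simplePrimes n) : x.Prime :=
  Nat.prime_of_mem_primeFactors (mem_simple.1 h).1

lemma prime_of_double (h : x ∈ doublePrimes n) : x.Prime :=
  Nat.prime_of_mem_primeFactors (mem_double.1 h).1

lemma prime_of_high (h : x ∈ highPrimes n) : x.Prime :=
  Nat.prime_of_mem_primeFactors (mem_high.1 h).1

lemma three_le_of_prime_of_ne_two (hx : x.Prime) (h2 : x ≠ 2) : 3 ≤ x := by
  have := hx.two_le
  omega

lemma disjoint_simple_double : Disjoint (simplePrimes n) (doublePrimes n) := by
  rw [Finset.disjoint_left]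
  intro a h h'
  rw [mem_simple] at h
  rw [mem_double] at h'
  omega

lemma disjoint_simple_high : Disjoint (simplePrimes n) (highPrimes n) := by
  rw [Finset.disjoint_left]
  intro a h h'
  rw [mem_simple] at h
  rw [mem_high] at h'
  omega

lemma disjoint_double_high : Disjoint (doublePrimes n) (highPrimes n) := by
  rw [Finset.disjoint_left]
  intro a h h'
  rw [mem_double] at h
  rw [mem_high] at h'
  omega

lemma localSigma_eq_sum (hx : x.Prime) :
    localSigma n x = ∑ k ∈ Finset.range (n.factorization x + 1), x ^ k := by
  rw [localSigma, sigma_one_apply_prime_pow hx]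

lemma localSigma_of_simple (h : x ∈ simplePrimes n) : localSigma n x = x + 1 := by
  rw [localSigma_eq_sum (prime_of_simple h), (mem_simple.1 h).2.2]
  simp [Finset.sum_range_succ]
  ring

lemma localSigma_of_double (h : x ∈ doublePrimes n) : localSigma n x = x ^ 2 + x + 1 := by
  rw [localSigma_eq_sum (prime_of_double h), (mem_double.1 h).2.2]
  simp [Finset.sum_range_succ]
  ring

lemma localSigma_pos (hx : x.Prime) : 0 < localSigma n x := by
  rw [localSigma_eq_sum hx, Finset.sum_range_succ']
  simp

lemma pow_le_localSigma (hx : x.Prime) {k : ℕ} (hk : k ≤ n.factorization x) :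
    x ^ k ≤ localSigma n x := by
  rw [localSigma_eq_sum hx]
  exact Finset.single_le_sum (f := fun k => x ^ k) (fun _ _ => Nat.zero_le _)
    (Finset.mem_range.2 (by omega))

/-- Apart from `3`, only primes `≡ 1 (mod 3)` divide `x ^ 2 + x + 1`. -/
lemma mod_three_of_dvd (hr : r.Prime) (h : r ∣ x ^ 2 + x + 1) : r = 3 ∨ r % 3 = 1 := by
  by_cases h3 : r = 3
  · exact Or.inl h3
  right
  have := Fact.mk hr
  have h0 : ((x : ZMod r)) ^ 2 + x + 1 = 0 := by
    have := (ZMod.natCast_eq_zero_iff (x ^ 2 + x + 1) r).2 h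
    push_cast at this
    exact this
  have hx1 : (x : ZMod r) ≠ 1 := by
    intro hx
    rw [hx] at h0
    have : ((3 : ℕ) : ZMod r) = 0 := by
      push_cast
      linear_combination h0
    rw [ZMod.natCast_eq_zero_iff] at this
    exact h3 ((Nat.prime_dvd_prime_iff_eq hr Nat.prime_three).1 this)
  have hx3 : (x : ZMod r) ^ 3 = 1 := by linear_combination ((x : ZMod r) - 1) * h0
  have hx0 : (x : ZMod r) ≠ 0 := by
    intro hx
    rw [hx] at h0
    simp at h0
  have ho : orderOf (x : ZMod r) = 3 :=
    orderOf_eq_prime hx3 hx1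
  have hd : 3 ∣ r - 1 := ho ▸ orderOf_dvd_of_pow_eq_one (ZMod.pow_card_sub_one_eq_one hx0)
  have := hr.two_le
  omega

lemma three_dvd_of_mod (h : x % 3 = 1) : 3 ∣ x ^ 2 + x + 1 := by
  obtain ⟨k, rfl⟩ : ∃ k, x = 3 * k + 1 := ⟨x / 3, by omega⟩
  exact ⟨3 * k ^ 2 + 3 * k + 1, by ring⟩

lemma mod_of_three_dvd (h : 3 ∣ x ^ 2 + x + 1) : x % 3 = 1 := by
  have h0 := Nat.mod_eq_zero_of_dvd h
  have : x % 3 < 3 := Nat.mod_lt _ (by norm_num)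
  interval_cases hx : x % 3 <;> simp [Nat.add_mod, Nat.pow_mod, hx] at h0 ⊢

lemma cases_mem (hx : x ∈ n.primeFactors) :
    x = 2 ∨ x ∈ simplePrimes n ∨ x ∈ doublePrimes n ∨ x ∈ highPrimes n := by
  have : 0 < n.factorization x :=
    (Nat.prime_of_mem_primeFactors hx).factorization_pos_of_dvd
      (Nat.mem_primeFactors.1 hx).2.2 (Nat.dvd_of_mem_primeFactors hx)
  rw [mem_simple, mem_double, mem_high]
  simp only [hx, true_and]
  omega

end Basic

namespace Admissible

variable {n : ℕ}

/-- The primes dividing a factor of `σ(n)` divide `n`. -/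
lemma mem_of_dvd (hn : Admissible n) {x r : ℕ} (hr : r.Prime) (hx : x ∈ n.primeFactors)
    (h : r ∣ localSigma n x) : r ∈ n.primeFactors := by
  have h1 : r ∣ (∏ x ∈ n.primeFactors, x) ^ 2 :=
    hn.prod_eq ▸ h.trans (Finset.dvd_prod_of_mem _ hx)
  obtain ⟨y, hy, hry⟩ := (Nat.Prime.prime hr).exists_mem_finset_dvd (hr.dvd_of_dvd_pow h1)
  rwa [(Nat.prime_dvd_prime_iff_eq hr (Nat.prime_of_mem_primeFactors hy)).1 hry]

/-- No prime divides three of the factors of `σ(n)`, as `σ(n)` is the square of a squarefree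
number. -/
lemma not_dvd_three (hn : Admissible n) {r x y z : ℕ} (hr : r.Prime) (hx : x ∈ n.primeFactors)
    (hy : y ∈ n.primeFactors) (hz : z ∈ n.primeFactors) (hxy : x ≠ y) (hxz : x ≠ z) (hyz : y ≠ z)
    (h1 : r ∣ localSigma n x) (h2 : r ∣ localSigma n y) (h3 : r ∣ localSigma n z) : False := by
  have hrn := hn.mem_of_dvd hr hx h1
  have hsub : ({x, y, z} : Finset ℕ) ⊆ n.primeFactors := by
    intro a ha
    simp only [Finset.mem_insert, Finset.mem_singleton] at ha
    rcases ha with rfl | rfl | rfl <;> assumption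
  have hd : r * (r * r) ∣ (∏ x ∈ n.primeFactors, x) ^ 2 := by
    rw [← hn.prod_eq]
    refine dvd_trans ?_ (Finset.prod_dvd_prod_of_subset _ _ (localSigma n) hsub)
    rw [Finset.prod_insert (by simp [hxy, hxz]), Finset.prod_insert (by simp [hyz]),
      Finset.prod_singleton]
    exact mul_dvd_mul h1 (mul_dvd_mul h2 h3)
  rw [← Finset.mul_prod_erase _ _ hrn, mul_pow] at hd
  have hd' : r ∣ (∏ x ∈ n.primeFactors.erase r, x) ^ 2 := by
    have : r ^ 2 * r ∣ r ^ 2 * (∏ x ∈ n.primeFactors.erase r, x) ^ 2 := by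
      convert hd using 1
      ring
    exact Nat.dvd_of_mul_dvd_mul_left (pow_pos hr.pos 2) this
  obtain ⟨w, hw, hrw⟩ := (Nat.Prime.prime hr).exists_mem_finset_dvd (hr.dvd_of_dvd_pow hd')
  have hw' := Finset.mem_erase.1 hw
  exact hw'.1 ((Nat.prime_dvd_prime_iff_eq hr (Nat.prime_of_mem_primeFactors hw'.2)).1 hrw).symm

/-- A product over the primes dividing `n`, split into the simple primes and `S` on the one hand,
and all other primes on the other. -/
lemma prod_split (hn : Admissible n) {M : Type*} [CommMonoid M] (g : ℕ → M)
    {S : Finset ℕ} (hS : S ⊆ doublePrimes n) :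
    ∏ x ∈ n.primeFactors, g x = (∏ x ∈ simplePrimes n, g x) * (∏ x ∈ S, g x) *
      (g 2 * (∏ x ∈ highPrimes n, g x) * ∏ x ∈ doublePrimes n \ S, g x) := by
  have h : n.primeFactors =
      insert 2 (simplePrimes n ∪ (doublePrimes n ∪ highPrimes n)) := by
    ext x
    simp only [Finset.mem_insert, Finset.mem_union]
    constructor
    · exact cases_mem
    · rintro (rfl | h | h | h)
      · exact hn.two_mem
      · exact (mem_simple.1 h).1
      · exact (mem_double.1 h).1
      · exact (mem_high.1 h).1
  have h2 : 2 ∉ simplePrimes n ∪ (doublePrimes n ∪ highPrimes n) := by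
    simp [mem_simple, mem_double, mem_high]
  conv_lhs => rw [h]
  rw [Finset.prod_insert h2, Finset.prod_union, Finset.prod_union disjoint_double_high,
    ← Finset.prod_sdiff hS]
  · ac_rfl
  · exact Finset.disjoint_union_right.2 ⟨disjoint_simple_double, disjoint_simple_high⟩

/-- The factors of `σ(n)` at the simple primes and at `S` have all their prime divisors in the set
`{2} ∪ highPrimes n ∪ S ∪ Z`. Comparing them with the squares of the primes in this set, and the
remaining factors with the remaining squares, leaves the same quotient `d`. -/
lemma exists_cofactor (hn : Admissible n) {S Z : Finset ℕ} (hS : S ⊆ doublePrimes n)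
    (hZ : Z ⊆ doublePrimes n) (hSZ : Disjoint S Z)
    (hcl : ∀ x ∈ simplePrimes n ∪ S, ∀ r, r.Prime → r ∣ localSigma n x →
      r = 2 ∨ r ∈ highPrimes n ∨ r ∈ S ∨ r ∈ Z) :
    ∃ d : ℕ, 0 < d ∧
      (∏ x ∈ simplePrimes n, localSigma n x) * (∏ x ∈ S, localSigma n x) * d =
        4 * (∏ x ∈ highPrimes n, x ^ 2) * (∏ x ∈ S, x ^ 2) * ∏ x ∈ Z, x ^ 2 ∧
      localSigma n 2 * (∏ x ∈ highPrimes n, localSigma n x) *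
        ∏ x ∈ doublePrimes n \ S, localSigma n x =
        d * (∏ x ∈ simplePrimes n, x ^ 2) * ∏ x ∈ (doublePrimes n \ S) \ Z, x ^ 2 := by
  have hZ' : Z ⊆ doublePrimes n \ S := fun z hz =>
    Finset.mem_sdiff.2 ⟨hZ hz, fun h => Finset.disjoint_left.1 hSZ h hz⟩
  have hmain := hn.prod_eq
  rw [← Finset.prod_pow, hn.prod_split _ hS, hn.prod_split _ hS,
    ← Finset.prod_sdiff (f := fun x => x ^ 2) hZ'] at hmain
  set A := (∏ x ∈ simplePrimes n, localSigma n x) * (∏ x ∈ S, localSigma n x) with hA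
  set C := localSigma n 2 * (∏ x ∈ highPrimes n, localSigma n x) *
        ∏ x ∈ doublePrimes n \ S, localSigma n x with hC
  set Y := 4 * (∏ x ∈ highPrimes n, x ^ 2) * (∏ x ∈ S, x ^ 2) * ∏ x ∈ Z, x ^ 2 with hY
  set V := (∏ x ∈ simplePrimes n, x ^ 2) * ∏ x ∈ (doublePrimes n \ S) \ Z, x ^ 2 with hV
  have hmain' : A * C = V * Y := by
    rw [hmain, hV, hY]
    ring
  have hApos : 0 < A := by
    refine Nat.mul_pos (Finset.prod_pos fun x hx => localSigma_pos (prime_of_simple hx))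
      (Finset.prod_pos fun x hx => localSigma_pos (prime_of_double (hS hx)))
  have hYpos : 0 < Y := by
    have h1 : 0 < ∏ x ∈ highPrimes n, x ^ 2 :=
      Finset.prod_pos fun x hx => pow_pos (prime_of_high hx).pos 2
    have h2 : 0 < ∏ x ∈ S, x ^ 2 :=
      Finset.prod_pos fun x hx => pow_pos (prime_of_double (hS hx)).pos 2
    have h3 : 0 < ∏ x ∈ Z, x ^ 2 :=
      Finset.prod_pos fun x hx => pow_pos (prime_of_double (hZ hx)).pos 2
    positivity
  have hcop : Nat.Coprime A V := by
    refine Nat.Coprime.symm (Nat.coprime_of_dvd fun r hr hrV hrA => ?_)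
    have hr1 : r = 2 ∨ r ∈ highPrimes n ∨ r ∈ S ∨ r ∈ Z := by
      rcases (Nat.Prime.dvd_mul hr).1 hrA with h | h
      · obtain ⟨x, hx, hrx⟩ := (Nat.Prime.prime hr).exists_mem_finset_dvd h
        exact hcl x (Finset.mem_union_left _ hx) r hr hrx
      · obtain ⟨x, hx, hrx⟩ := (Nat.Prime.prime hr).exists_mem_finset_dvd h
        exact hcl x (Finset.mem_union_right _ hx) r hr hrx
    have hr2 : r ∈ simplePrimes n ∨ r ∈ (doublePrimes n \ S) \ Z := by
      rcases (Nat.Prime.dvd_mul hr).1 hrV with h | h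
      · obtain ⟨x, hx, hrx⟩ := (Nat.Prime.prime hr).exists_mem_finset_dvd h
        rw [(Nat.prime_dvd_prime_iff_eq hr (prime_of_simple hx)).1 (hr.dvd_of_dvd_pow hrx)]
        exact Or.inl hx
      · obtain ⟨x, hx, hrx⟩ := (Nat.Prime.prime hr).exists_mem_finset_dvd h
        have hx' := hx
        simp only [Finset.mem_sdiff] at hx'
        rw [(Nat.prime_dvd_prime_iff_eq hr (prime_of_double hx'.1.1)).1 (hr.dvd_of_dvd_pow hrx)]
        exact Or.inr hx
    have hZr : r ∈ Z → r ∈ doublePrimes n := fun h => hZ h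
    have hSr : r ∈ S → r ∈ doublePrimes n := fun h => hS h
    simp only [Finset.mem_sdiff, mem_simple, mem_high, mem_double] at hr1 hr2 hZr hSr
    grind
  obtain ⟨d, hd⟩ : A ∣ Y := hcop.dvd_of_dvd_mul_left ⟨C, hmain'.symm⟩
  refine ⟨d, Nat.pos_of_ne_zero ?_, hd.symm, ?_⟩
  · rintro rfl
    omega
  · refine Nat.eq_of_mul_eq_mul_left hApos ?_
    rw [hmain', hd, hV]
    ring

end Admissible

/-! ### The inequality from the cofactor identity -/

lemma one_le_prod {s : Finset ℕ} {f : ℕ → ℝ} (h : ∀ x ∈ s, 1 ≤ f x) : 1 ≤ ∏ x ∈ s, f x :=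
  Finset.prod_induction f (fun y => 1 ≤ y) (fun _ _ => one_le_mul_of_one_le_of_one_le) le_rfl h

lemma le_prod_of_one_le {s : Finset ℕ} {f : ℕ → ℝ} (h : ∀ x ∈ s, 1 ≤ f x) {a : ℕ} (ha : a ∈ s) :
    f a ≤ ∏ x ∈ s, f x := by
  rw [← Finset.mul_prod_erase _ _ ha]
  refine le_mul_of_one_le_right (by linarith [h a ha]) (one_le_prod fun x hx => ?_)
  exact h x (Finset.mem_of_mem_erase hx)

lemma mul_le_prod_of_one_le {s : Finset ℕ} {f : ℕ → ℝ} (h : ∀ x ∈ s, 1 ≤ f x) {a b : ℕ}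
    (ha : a ∈ s) (hb : b ∈ s) (hab : a ≠ b) : f a * f b ≤ ∏ x ∈ s, f x := by
  rw [← Finset.mul_prod_erase _ _ ha]
  refine mul_le_mul_of_nonneg_left ?_ (by linarith [h a ha])
  exact le_prod_of_one_le (fun x hx => h x (Finset.mem_of_mem_erase hx))
    (Finset.mem_erase.2 ⟨hab.symm, hb⟩)

/-- `d` is the common quotient of `Admissible.exists_cofactor` for the sets `S` and `Z`; `bound` is
the inequality that results from eliminating `∏ x ∈ highPrimes n, x ^ 2`. -/
structure IsCofactor (n : ℕ) (S Z : Finset ℕ) (d : ℕ) : Prop where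
  subset : S ⊆ doublePrimes n
  subset' : Z ⊆ doublePrimes n
  closed : ∀ x ∈ simplePrimes n ∪ S, ∀ r, r.Prime → r ∣ localSigma n x →
      r = 2 ∨ r ∈ highPrimes n ∨ r ∈ S ∨ r ∈ Z
  pos : 0 < d
  inner : (∏ x ∈ simplePrimes n, localSigma n x) * (∏ x ∈ S, localSigma n x) * d =
        4 * (∏ x ∈ highPrimes n, x ^ 2) * (∏ x ∈ S, x ^ 2) * ∏ x ∈ Z, x ^ 2
  outer : localSigma n 2 * (∏ x ∈ highPrimes n, localSigma n x) *
        ∏ x ∈ doublePrimes n \ S, localSigma n x =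
        d * (∏ x ∈ simplePrimes n, x ^ 2) * ∏ x ∈ (doublePrimes n \ S) \ Z, x ^ 2
  bound : (localSigma n 2 * d : ℝ) * (∏ x ∈ S, (localSigma n x / x ^ 2 : ℝ)) ^ 2 *
    (∏ x ∈ highPrimes n, (localSigma n x / x ^ 4 : ℝ)) *
    (∏ x ∈ doublePrimes n \ S, (localSigma n x / x ^ 2 : ℝ)) < 16 * ∏ x ∈ Z, (x : ℝ) ^ 2

lemma Admissible.exists_isCofactor {n : ℕ} (hn : Admissible n) {S Z : Finset ℕ}
    (hS : S ⊆ doublePrimes n) (hZ : Z ⊆ doublePrimes n) (hSZ : Disjoint S Z)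
    (hcl : ∀ x ∈ simplePrimes n ∪ S, ∀ r, r.Prime → r ∣ localSigma n x →
      r = 2 ∨ r ∈ highPrimes n ∨ r ∈ S ∨ r ∈ Z) :
    ∃ d, IsCofactor n S Z d := by
  obtain ⟨d, hd, h1, h2⟩ := hn.exists_cofactor hS hZ hSZ hcl
  refine ⟨d, hS, hZ, hcl, hd, h1, h2, ?_⟩
  have hZ' : Z ⊆ doublePrimes n \ S := fun z hz =>
    Finset.mem_sdiff.2 ⟨hZ hz, fun h => Finset.disjoint_left.1 hSZ h hz⟩
  have pos_prod : ∀ (s : Finset ℕ) (k : ℕ), (∀ x ∈ s, x.Prime) → (0 : ℝ) < ∏ x ∈ s, (x : ℝ) ^ k :=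
    fun s k hs => Finset.prod_pos fun x hx => pow_pos (by exact_mod_cast (hs x hx).pos) k
  have hQS := pos_prod S 2 fun x hx => prime_of_double (hS hx)
  have hQZ := pos_prod Z 2 fun x hx => prime_of_double (hZ hx)
  have hQT := pos_prod ((doublePrimes n \ S) \ Z) 2 fun x hx =>
    prime_of_double (Finset.mem_sdiff.1 (Finset.mem_sdiff.1 hx).1).1
  have hK := pos_prod (highPrimes n) 2 fun x hx => prime_of_high hx
  have hP := pos_prod (simplePrimes n) 1 fun x hx => prime_of_simple hx
  have h4 : ∏ x ∈ highPrimes n, (x : ℝ) ^ 4 = (∏ x ∈ highPrimes n, (x : ℝ) ^ 2) ^ 2 := by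
    rw [← Finset.prod_pow]
    exact Finset.prod_congr rfl fun x _ => by ring
  have hP2 : ∏ x ∈ simplePrimes n, (x : ℝ) ^ 2 = (∏ x ∈ simplePrimes n, (x : ℝ) ^ 1) ^ 2 := by
    rw [← Finset.prod_pow]
    exact Finset.prod_congr rfl fun x _ => by ring
  have hPP : ∏ x ∈ simplePrimes n, (x : ℝ) ^ 1 < ∏ x ∈ simplePrimes n, (localSigma n x : ℝ) := by
    refine Finset.prod_lt_prod_of_nonempty (fun x hx => ?_) (fun x hx => ?_) ?_
    · exact pow_pos (by exact_mod_cast (prime_of_simple hx).pos) 1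
    · rw [localSigma_of_simple hx]
      push_cast
      linarith
    · rcases hn.shape with ⟨p, h, _⟩ | ⟨p, p', _, h, _⟩ | ⟨p, x, h, _⟩ <;> rw [h] <;> simp
  have h1' := congrArg (Nat.cast : ℕ → ℝ) h1
  have h2' := congrArg (Nat.cast : ℕ → ℝ) h2
  push_cast at h1' h2'
  rw [hP2] at h2'
  have hF2 : (0 : ℝ) < localSigma n 2 := by exact_mod_cast localSigma_pos Nat.prime_two
  have hFB : (0 : ℝ) < ∏ x ∈ highPrimes n, (localSigma n x : ℝ) :=
    Finset.prod_pos fun x hx => by exact_mod_cast localSigma_pos (prime_of_high hx)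
  have hFS : (0 : ℝ) < ∏ x ∈ S, (localSigma n x : ℝ) :=
    Finset.prod_pos fun x hx => by exact_mod_cast localSigma_pos (prime_of_double (hS hx))
  have hFT : (0 : ℝ) < ∏ x ∈ doublePrimes n \ S, (localSigma n x : ℝ) :=
    Finset.prod_pos fun x hx => by
      exact_mod_cast localSigma_pos (prime_of_double (Finset.mem_sdiff.1 hx).1)
  rw [Finset.prod_div_distrib, Finset.prod_div_distrib, Finset.prod_div_distrib, h4,
    ← Finset.prod_sdiff (f := fun x : ℕ => (x : ℝ) ^ 2) hZ']
  have hd' : (0 : ℝ) < d := by exact_mod_cast hd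
  generalize ∏ x ∈ S, (x : ℝ) ^ 2 = QS at *
  generalize ∏ x ∈ Z, (x : ℝ) ^ 2 = QZ at *
  generalize ∏ x ∈ (doublePrimes n \ S) \ Z, (x : ℝ) ^ 2 = QT at *
  generalize ∏ x ∈ highPrimes n, (x : ℝ) ^ 2 = K at *
  generalize ∏ x ∈ simplePrimes n, (x : ℝ) ^ 1 = P at *
  generalize ∏ x ∈ simplePrimes n, (localSigma n x : ℝ) = P' at *
  generalize ∏ x ∈ highPrimes n, (localSigma n x : ℝ) = FB at *
  generalize ∏ x ∈ S, (localSigma n x : ℝ) = FS at *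
  generalize ∏ x ∈ doublePrimes n \ S, (localSigma n x : ℝ) = FT at *
  generalize (localSigma n 2 : ℝ) = F2 at *
  generalize (d : ℝ) = D at *
  have e : F2 * D * (FS / QS) ^ 2 * (FB / K ^ 2) * (FT / (QT * QZ)) * P' ^ 2
      = 16 * QZ * P ^ 2 := by
    field_simp
    have e1 : (P' * FS * D) ^ 2 = 16 * K ^ 2 * QS ^ 2 * QZ ^ 2 := by
      rw [h1']
      ring
    refine mul_left_cancel₀ hd'.ne' ?_
    linear_combination (F2 * FB * FT) * e1 + 16 * K ^ 2 * QS ^ 2 * QZ ^ 2 * h2'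
  have hsq : P ^ 2 < P' ^ 2 := pow_lt_pow_left₀ hPP hP.le (by norm_num)
  have hP' : 0 < P' ^ 2 := pow_pos (hP.trans hPP) 2
  refine lt_of_mul_lt_mul_right (a := P' ^ 2) ?_ hP'.le
  rw [e]
  exact mul_lt_mul_of_pos_left hsq (by positivity)

namespace IsCofactor

variable {n d : ℕ} {S Z : Finset ℕ}

lemma one_le_double {x : ℕ} (hx : x ∈ doublePrimes n) :
    (1 : ℝ) ≤ localSigma n x / x ^ 2 := by
  have hp := prime_of_double hx
  have h : x ^ 2 ≤ localSigma n x := pow_le_localSigma hp (mem_double.1 hx).2.2.ge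
  rw [one_le_div (pow_pos (by exact_mod_cast hp.pos) 2)]
  exact_mod_cast h

lemma one_le_high (hn : Admissible n) {x : ℕ} (hx : x ∈ highPrimes n) :
    (1 : ℝ) ≤ localSigma n x / x ^ 4 := by
  have hp := prime_of_high hx
  have h : x ^ 4 ≤ localSigma n x := pow_le_localSigma hp (hn.four_le x hx)
  rw [one_le_div (pow_pos (by exact_mod_cast hp.pos) 4)]
  exact_mod_cast h

lemma one_le_inner (h : IsCofactor n S Z d) :
    (1 : ℝ) ≤ ∏ x ∈ S, (localSigma n x / x ^ 2 : ℝ) :=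
  one_le_prod fun _ hx => one_le_double (h.subset hx)

lemma bound_of_le (h : IsCofactor n S Z d) {a b c : ℝ}
    (ha : 1 ≤ a) (hb : 1 ≤ b) (hc : 1 ≤ c)
    (haS : a ≤ ∏ x ∈ S, (localSigma n x / x ^ 2 : ℝ))
    (hbB : b ≤ ∏ x ∈ highPrimes n, (localSigma n x / x ^ 4 : ℝ))
    (hcT : c ≤ ∏ x ∈ doublePrimes n \ S, (localSigma n x / x ^ 2 : ℝ)) :
    (localSigma n 2 * d : ℝ) * a ^ 2 * b * c < 16 * ∏ x ∈ Z, (x : ℝ) ^ 2 := by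
  refine lt_of_le_of_lt ?_ h.bound
  have := h.one_le_inner
  have : (1 : ℝ) ≤ ∏ x ∈ highPrimes n, (localSigma n x / x ^ 4 : ℝ) := hb.trans hbB
  gcongr

lemma one_le_prod_high (hn : Admissible n) :
    (1 : ℝ) ≤ ∏ x ∈ highPrimes n, (localSigma n x / x ^ 4 : ℝ) :=
  one_le_prod fun _ hx => one_le_high hn hx

lemma one_le_outer : (1 : ℝ) ≤ ∏ x ∈ doublePrimes n \ S, (localSigma n x / x ^ 2 : ℝ) :=
  one_le_prod fun _ hx => one_le_double (Finset.mem_sdiff.1 hx).1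

lemma mul_lt_sixteen (hn : Admissible n) (h : IsCofactor n S ∅ d) : localSigma n 2 * d < 16 := by
  have := h.bound_of_le le_rfl le_rfl le_rfl h.one_le_inner (one_le_prod_high hn) one_le_outer
  simp only [one_pow, mul_one, Finset.prod_empty] at this
  exact_mod_cast this

lemma bound_high (hn : Admissible n) (h : IsCofactor n S ∅ d) {x : ℕ} (hx : x ∈ highPrimes n) :
    localSigma n 2 * d * localSigma n x < 16 * x ^ 4 := by
  have := h.bound_of_le le_rfl (one_le_high hn hx) le_rfl h.one_le_inner
    (le_prod_of_one_le (fun _ hx => one_le_high hn hx) hx) one_le_outer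
  have hp : (0 : ℝ) < x ^ 4 := pow_pos (by exact_mod_cast (prime_of_high hx).pos) 4
  simp only [one_pow, mul_one, Finset.prod_empty] at this
  rw [← mul_div_assoc, div_lt_iff₀ hp] at this
  exact_mod_cast this

lemma bound_outer (hn : Admissible n) (h : IsCofactor n S ∅ d) {x : ℕ}
    (hx : x ∈ doublePrimes n \ S) : localSigma n 2 * d * (x ^ 2 + x + 1) < 16 * x ^ 2 := by
  have hx' := (Finset.mem_sdiff.1 hx).1
  have := h.bound_of_le le_rfl le_rfl (one_le_double hx') h.one_le_inner
    (one_le_prod_high hn)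
    (le_prod_of_one_le (fun _ hx => one_le_double (Finset.mem_sdiff.1 hx).1) hx)
  have hp : (0 : ℝ) < x ^ 2 := pow_pos (by exact_mod_cast (prime_of_double hx').pos) 2
  simp only [one_pow, mul_one, Finset.prod_empty] at this
  rw [← mul_div_assoc, div_lt_iff₀ hp, localSigma_of_double hx'] at this
  exact_mod_cast this

lemma bound_inner (hn : Admissible n) (h : IsCofactor n S ∅ d) {x : ℕ} (hx : x ∈ S) :
    localSigma n 2 * d * (x ^ 2 + x + 1) ^ 2 < 16 * x ^ 4 := by
  have hx' := h.subset hx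
  have := h.bound_of_le (one_le_double hx') le_rfl le_rfl
    (le_prod_of_one_le (fun _ hx => one_le_double (h.subset hx)) hx) (one_le_prod_high hn)
    one_le_outer
  have hp : (0 : ℝ) < (x ^ 2) ^ 2 :=
    pow_pos (pow_pos (by exact_mod_cast (prime_of_double hx').pos) 2) 2
  simp only [mul_one, Finset.prod_empty] at this
  rw [div_pow, ← mul_div_assoc, div_lt_iff₀ hp, localSigma_of_double hx', ← pow_mul] at this
  exact_mod_cast this

/-- A prime dividing one of the remaining factors of `σ(n)` divides `d`, or is one of the remaining
primes. -/
lemma of_dvd_outer (h : IsCofactor n S Z d) {x r : ℕ} (hr : r.Prime)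
    (hx : x = 2 ∨ x ∈ highPrimes n ∨ x ∈ doublePrimes n \ S) (hd : r ∣ localSigma n x) :
    r ∣ d ∨ r ∈ simplePrimes n ∨ r ∈ (doublePrimes n \ S) \ Z := by
  have h1 : r ∣ d * (∏ x ∈ simplePrimes n, x ^ 2) * ∏ x ∈ (doublePrimes n \ S) \ Z, x ^ 2 := by
    rw [← h.outer]
    rcases hx with rfl | hx | hx
    · exact dvd_mul_of_dvd_left (dvd_mul_of_dvd_left hd _) _
    · exact dvd_mul_of_dvd_left (dvd_mul_of_dvd_right (hd.trans (Finset.dvd_prod_of_mem _ hx)) _) _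
    · exact dvd_mul_of_dvd_right (hd.trans (Finset.dvd_prod_of_mem _ hx)) _
  rcases (Nat.Prime.dvd_mul hr).1 h1 with h1 | h1
  · rcases (Nat.Prime.dvd_mul hr).1 h1 with h1 | h1
    · exact Or.inl h1
    · obtain ⟨y, hy, hry⟩ := (Nat.Prime.prime hr).exists_mem_finset_dvd h1
      rw [(Nat.prime_dvd_prime_iff_eq hr (prime_of_simple hy)).1 (hr.dvd_of_dvd_pow hry)]
      exact Or.inr (Or.inl hy)
  · obtain ⟨y, hy, hry⟩ := (Nat.Prime.prime hr).exists_mem_finset_dvd h1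
    have hy' := hy
    simp only [Finset.mem_sdiff] at hy'
    rw [(Nat.prime_dvd_prime_iff_eq hr (prime_of_double hy'.1.1)).1 (hr.dvd_of_dvd_pow hry)]
    exact Or.inr (Or.inr hy)

/-- A prime dividing `d` is one of the primes `2`, `highPrimes n`, `S`, `Z`. -/
lemma of_dvd (h : IsCofactor n S Z d) {r : ℕ} (hr : r.Prime) (hd : r ∣ d) :
    r = 2 ∨ r ∈ highPrimes n ∨ r ∈ S ∨ r ∈ Z := by
  have h1 := h.inner ▸ dvd_mul_of_dvd_right hd _
  rcases (Nat.Prime.dvd_mul hr).1 h1 with h1 | h1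
  · rcases (Nat.Prime.dvd_mul hr).1 h1 with h1 | h1
    · rcases (Nat.Prime.dvd_mul hr).1 h1 with h1 | h1
      · left
        have : r ∣ 2 ^ 2 := h1
        exact (Nat.prime_dvd_prime_iff_eq hr Nat.prime_two).1 (hr.dvd_of_dvd_pow this)
      · obtain ⟨y, hy, hry⟩ := (Nat.Prime.prime hr).exists_mem_finset_dvd h1
        rw [(Nat.prime_dvd_prime_iff_eq hr (prime_of_high hy)).1 (hr.dvd_of_dvd_pow hry)]
        exact Or.inr (Or.inl hy)
    · obtain ⟨y, hy, hry⟩ := (Nat.Prime.prime hr).exists_mem_finset_dvd h1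
      rw [(Nat.prime_dvd_prime_iff_eq hr (prime_of_double (h.subset hy))).1
        (hr.dvd_of_dvd_pow hry)]
      exact Or.inr (Or.inr (Or.inl hy))
  · obtain ⟨y, hy, hry⟩ := (Nat.Prime.prime hr).exists_mem_finset_dvd h1
    rw [(Nat.prime_dvd_prime_iff_eq hr (prime_of_double (h.subset' hy))).1
      (hr.dvd_of_dvd_pow hry)]
    exact Or.inr (Or.inr (Or.inr hy))

end IsCofactor

/-! ### Parity and exponents for a closed set -/

section

variable {n d : ℕ} {S : Finset ℕ}

lemma localSigma_two : localSigma n 2 + 1 = 2 ^ (n.factorization 2 + 1) := by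
  rw [localSigma_eq_sum Nat.prime_two]
  exact Nat.geomSum_eq (le_refl 2) _ ▸ by
    simp [Nat.sub_add_cancel Nat.one_le_two_pow]

lemma Admissible.factorization_two_pos (hn : Admissible n) : 0 < n.factorization 2 :=
  Nat.prime_two.factorization_pos_of_dvd (Nat.mem_primeFactors.1 hn.two_mem).2.2
    (Nat.dvd_of_mem_primeFactors hn.two_mem)

lemma Admissible.three_le_localSigma_two (hn : Admissible n) : 3 ≤ localSigma n 2 := by
  have h1 := localSigma_two (n := n)
  have h2 : 2 ^ 2 ≤ 2 ^ (n.factorization 2 + 1) :=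
    Nat.pow_le_pow_right (by norm_num) (by have := hn.factorization_two_pos; omega)
  omega

/-- The two shapes that are left once a prime with odd exponent at least `5` is excluded. -/
def EvenShape (n : ℕ) : Prop :=
  (∃ p, simplePrimes n = {p} ∧ p % 8 = 3) ∨
    ∃ p p', p ≠ p' ∧ simplePrimes n = {p, p'} ∧ p % 4 = 1 ∧ p' % 4 = 1

namespace IsCofactor

/-- A prime `x ≥ 5` with exponent at least `5` has `σ(x ^ e) ≥ 6 * x ^ 4`, too much for the bound. -/
lemma even_shape (hn : Admissible n) (h : IsCofactor n S ∅ d) :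
    EvenShape n ∧ ∀ x ∈ highPrimes n, Even (n.factorization x) := by
  rcases hn.shape with ⟨p, h1, h2, h3⟩ | ⟨p, p', h0, h1, h2, h3, h4⟩ | ⟨p, x, h1, h2, h3, h4⟩
  · exact ⟨Or.inl ⟨p, h1, h2⟩, h3⟩
  · exact ⟨Or.inr ⟨p, p', h0, h1, h2, h3⟩, h4⟩
  · exfalso
    have hb := h.bound_high hn h2
    have hF := hn.three_le_localSigma_two
    have hx : x ^ 5 + x ^ 4 ≤ localSigma n x := by
      rw [localSigma_eq_sum (prime_of_high h2)]
      have : ({4, 5} : Finset ℕ) ⊆ Finset.range (n.factorization x + 1) := by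
        intro a ha
        simp only [Finset.mem_insert, Finset.mem_singleton, Finset.mem_range] at ha ⊢
        omega
      refine le_trans ?_ (Finset.sum_le_sum_of_subset this)
      simp [add_comm]
    have : 3 * 1 * (6 * x ^ 4) ≤ localSigma n 2 * d * localSigma n x := by
      refine Nat.mul_le_mul (Nat.mul_le_mul hF h.pos) (le_trans ?_ hx)
      nlinarith [Nat.mul_le_mul_right (x ^ 4) h3]
    have : 0 < x ^ 4 := by positivity
    omega

lemma factorization_high (hn : Admissible n) (h : IsCofactor n S ∅ d) {x : ℕ}
    (hx : x ∈ highPrimes n) : n.factorization x = 4 := by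
  by_contra hne
  have h4 := hn.four_le x hx
  have he := (h.even_shape hn).2 x hx
  have h6 : 6 ≤ n.factorization x := by
    obtain ⟨k, hk⟩ := he
    omega
  have hb := h.bound_high hn hx
  have hp := prime_of_high hx
  have h3 := three_le_of_prime_of_ne_two hp (mem_high.1 hx).2.1
  have h9 : 9 * x ^ 4 ≤ localSigma n x := by
    refine le_trans ?_ (pow_le_localSigma hp h6)
    calc 9 * x ^ 4 ≤ x ^ 2 * x ^ 4 := Nat.mul_le_mul_right _ (by nlinarith)
      _ = x ^ 6 := by ring
  have : 3 * 1 * (9 * x ^ 4) ≤ localSigma n 2 * d * localSigma n x :=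
    Nat.mul_le_mul (Nat.mul_le_mul hn.three_le_localSigma_two h.pos) h9
  have : 0 < x ^ 4 := pow_pos hp.pos 4
  omega

lemma localSigma_high (hn : Admissible n) (h : IsCofactor n S ∅ d) {x : ℕ}
    (hx : x ∈ highPrimes n) : localSigma n x = x ^ 4 + x ^ 3 + x ^ 2 + x + 1 := by
  rw [localSigma_eq_sum (prime_of_high hx), h.factorization_high hn hx]
  simp [Finset.sum_range_succ]
  ring

/-- `4` divides the contribution of the simple primes, and `8` does not divide `σ(n)`. -/
lemma odd_cofactor (hn : Admissible n) (h : IsCofactor n S ∅ d) : Odd d := by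
  have h4 : 4 ∣ ∏ x ∈ simplePrimes n, localSigma n x := by
    rcases (h.even_shape hn).1 with ⟨p, hE, hp⟩ | ⟨p, p', hne, hE, hp, hp'⟩
    · have hm : p ∈ simplePrimes n := by simp [hE]
      rw [hE, Finset.prod_singleton, localSigma_of_simple hm]
      omega
    · have hm : p ∈ simplePrimes n := by simp [hE]
      have hm' : p' ∈ simplePrimes n := by simp [hE]
      rw [hE, Finset.prod_pair hne, localSigma_of_simple hm, localSigma_of_simple hm']
      have : 2 * 2 ∣ (p + 1) * (p' + 1) := mul_dvd_mul (by omega) (by omega)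
      exact this
  obtain ⟨m, hm⟩ := h4
  have hin := h.inner
  rw [hm, Finset.prod_empty, mul_one] at hin
  have hin' : m * (∏ x ∈ S, localSigma n x) * d =
      (∏ x ∈ highPrimes n, x ^ 2) * ∏ x ∈ S, x ^ 2 := by
    refine Nat.eq_of_mul_eq_mul_left (show 0 < 4 by norm_num) ?_
    linarith
  by_contra hd
  rw [Nat.not_odd_iff_even, even_iff_two_dvd] at hd
  have h2 : 2 ∣ (∏ x ∈ highPrimes n, x ^ 2) * ∏ x ∈ S, x ^ 2 :=
    hin' ▸ dvd_mul_of_dvd_right hd _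
  rcases (Nat.Prime.dvd_mul Nat.prime_two).1 h2 with h2 | h2
  · obtain ⟨y, hy, hry⟩ := (Nat.Prime.prime Nat.prime_two).exists_mem_finset_dvd h2
    exact (mem_high.1 hy).2.1 ((Nat.prime_dvd_prime_iff_eq Nat.prime_two (prime_of_high hy)).1
      (Nat.prime_two.dvd_of_dvd_pow hry)).symm
  · obtain ⟨y, hy, hry⟩ := (Nat.Prime.prime Nat.prime_two).exists_mem_finset_dvd h2
    have hy := h.subset hy
    exact (mem_double.1 hy).2.1 ((Nat.prime_dvd_prime_iff_eq Nat.prime_two (prime_of_double hy)).1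
      (Nat.prime_two.dvd_of_dvd_pow hry)).symm

lemma outer_of_dvd_double (h : IsCofactor n S ∅ d) {x r : ℕ} (hr : r.Prime)
    (hx : x ∈ doublePrimes n \ S) (hd : r ∣ x ^ 2 + x + 1) :
    r ∣ d ∨ r ∈ simplePrimes n ∨ r ∈ doublePrimes n \ S := by
  rw [← localSigma_of_double (n := n) (Finset.mem_sdiff.1 hx).1] at hd
  simpa using h.of_dvd_outer hr (Or.inr (Or.inr hx)) hd

lemma outer_of_dvd_two (h : IsCofactor n S ∅ d) {r : ℕ} (hr : r.Prime)
    (hd : r ∣ localSigma n 2) :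
    r ∣ d ∨ r ∈ simplePrimes n ∨ r ∈ doublePrimes n \ S := by
  simpa using h.of_dvd_outer hr (Or.inl rfl) hd

lemma outer_of_dvd_high (hn : Admissible n) (h : IsCofactor n S ∅ d) {x r : ℕ} (hr : r.Prime)
    (hx : x ∈ highPrimes n) (hd : r ∣ x ^ 4 + x ^ 3 + x ^ 2 + x + 1) :
    r ∣ d ∨ r ∈ simplePrimes n ∨ r ∈ doublePrimes n \ S := by
  rw [← h.localSigma_high hn hx] at hd
  simpa using h.of_dvd_outer hr (Or.inr (Or.inl hx)) hd

lemma inner_of_dvd_simple (h : IsCofactor n S ∅ d) {x r : ℕ} (hr : r.Prime)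
    (hx : x ∈ simplePrimes n) (hd : r ∣ x + 1) :
    r = 2 ∨ r ∈ highPrimes n ∨ r ∈ S := by
  rw [← localSigma_of_simple hx] at hd
  simpa using h.closed x (Finset.mem_union_left _ hx) r hr hd

lemma inner_of_dvd_double (h : IsCofactor n S ∅ d) {x r : ℕ} (hr : r.Prime)
    (hx : x ∈ S) (hd : r ∣ x ^ 2 + x + 1) :
    r = 2 ∨ r ∈ highPrimes n ∨ r ∈ S := by
  rw [← localSigma_of_double (n := n) (h.subset hx)] at hd
  simpa using h.closed x (Finset.mem_union_right _ hx) r hr hd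

end IsCofactor

/-- As `3` divides at most two factors of `σ(n)`, and divides the factor at every double prime
`≡ 1 (mod 3)`, at most two double primes are `≡ 1 (mod 3)`, and only one if a further factor of
`σ(n)` is divisible by `3`. -/
lemma Admissible.false_of_one_mod_three (hn : Admissible n) {x y z : ℕ} (hx : x ∈ n.primeFactors)
    (hx3 : 3 ∣ localSigma n x) (hy : y ∈ doublePrimes n) (hz : z ∈ doublePrimes n)
    (hy3 : y % 3 = 1) (hz3 : z % 3 = 1) (hxy : x ≠ y) (hxz : x ≠ z) (hyz : y ≠ z) : False := by
  refine hn.not_dvd_three Nat.prime_three hx (mem_double.1 hy).1 (mem_double.1 hz).1 hxy hxz hyz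
    hx3 ?_ ?_
  · rw [localSigma_of_double hy]
    exact three_dvd_of_mod hy3
  · rw [localSigma_of_double hz]
    exact three_dvd_of_mod hz3

end

/-! ### A closed set occurs only for `n = 1782` -/

section

variable {n d : ℕ} {S : Finset ℕ}

lemma EvenShape.eq_of_mod (h : EvenShape n) {p x : ℕ} (hp : p ∈ simplePrimes n) (h3 : p % 8 = 3)
    (hx : x ∈ simplePrimes n) : x = p := by
  rcases h with ⟨a, hE, ha⟩ | ⟨a, b, hne, hE, ha, hb⟩ <;>
    simp only [hE, Finset.mem_insert, Finset.mem_singleton] at hp hx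
  · rw [hx, hp]
  · rcases hp with rfl | rfl <;> omega

lemma EvenShape.not_three (h : EvenShape n) {x y z : ℕ} (hx : x ∈ simplePrimes n)
    (hy : y ∈ simplePrimes n) (hz : z ∈ simplePrimes n) (hxy : x ≠ y) (hxz : x ≠ z)
    (hyz : y ≠ z) : False := by
  rcases h with ⟨a, hE, ha⟩ | ⟨a, b, hne, hE, ha, hb⟩ <;>
    simp only [hE, Finset.mem_insert, Finset.mem_singleton] at hx hy hz <;> omega

namespace IsCofactor

lemma not_five_dvd (hn : Admissible n) (h : IsCofactor n S ∅ d) : ¬ 5 ∣ d := by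
  intro h5
  have hd := Nat.le_of_dvd h.pos h5
  have h15 : 3 * 5 ≤ localSigma n 2 * d := Nat.mul_le_mul hn.three_le_localSigma_two hd
  rcases h.of_dvd Nat.prime_five h5 with h' | h' | h' | h'
  · omega
  · have := h.bound_high hn h'
    rw [h.localSigma_high hn h'] at this
    omega
  · have := h.bound_inner hn h'
    omega
  · simp at h'

lemma localSigma_two_ne_seven (hn : Admissible n) (h : IsCofactor n S ∅ d) :
    localSigma n 2 ≠ 7 := by
  intro h7
  have hlt := h.mul_lt_sixteen hn
  have hodd := h.odd_cofactor hn
  rw [h7] at hlt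
  obtain rfl : d = 1 := by
    obtain ⟨k, rfl⟩ := hodd
    omega
  have hsh := (h.even_shape hn).1
  have hout : ∀ {x r : ℕ}, r.Prime → x ∈ doublePrimes n \ S → r ∣ x ^ 2 + x + 1 →
      r ∈ simplePrimes n ∨ r ∈ doublePrimes n \ S := fun hr hx hd =>
    (h.outer_of_dvd_double hr hx hd).resolve_left hr.not_dvd_one
  have m7 : 7 ∈ doublePrimes n \ S := by
    rcases h.outer_of_dvd_two (r := 7) (by norm_num) (by rw [h7]) with h' | h' | h'
    · norm_num at h'
    · have := hn.residue 7 h'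
      omega
    · exact h'
  have d7 := (Finset.mem_sdiff.1 m7).1
  have s7 : 3 ∣ localSigma n 7 := by
    rw [localSigma_of_double d7]
    norm_num
  rcases hout (r := 19) (by norm_num) m7 (by norm_num) with h19 | h19
  · -- `19 ≡ 3 (mod 8)` is then the only simple prime, which puts `3`, `13`, `61` among the
    -- remaining primes.
    have huniq : ∀ x ∈ simplePrimes n, x = 19 := fun x hx =>
      hsh.eq_of_mod h19 (by norm_num) hx
    have m3 := (hout (r := 3) (by norm_num) m7 (by norm_num)).resolve_left
      fun hx => by simpa using huniq _ hx
    have m13 := (hout (r := 13) (by norm_num) m3 (by norm_num)).resolve_left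
      fun hx => by simpa using huniq _ hx
    have m61 := (hout (r := 61) (by norm_num) m13 (by norm_num)).resolve_left
      fun hx => by simpa using huniq _ hx
    exact hn.false_of_one_mod_three (mem_double.1 d7).1 s7 (Finset.mem_sdiff.1 m13).1
      (Finset.mem_sdiff.1 m61).1 (by norm_num) (by norm_num) (by norm_num) (by norm_num)
      (by norm_num)
  · have m127 : 127 ∈ doublePrimes n \ S := by
      rcases hout (r := 127) (by norm_num) h19 (by norm_num) with h' | h'
      · have := hn.residue 127 h'
        omega
      · exact h'
    exact hn.false_of_one_mod_three (mem_double.1 d7).1 s7 (Finset.mem_sdiff.1 h19).1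
      (Finset.mem_sdiff.1 m127).1 (by norm_num) (by norm_num) (by norm_num) (by norm_num)
      (by norm_num)

lemma localSigma_two_ne_fifteen (hn : Admissible n) (h : IsCofactor n S ∅ d) :
    localSigma n 2 ≠ 15 := by
  intro h15
  have hlt := h.mul_lt_sixteen hn
  have hpos := h.pos
  rw [h15] at hlt
  obtain rfl : d = 1 := by omega
  have hsh := (h.even_shape hn).1
  have key : ∀ r, r.Prime → r ∣ 15 → r ∉ doublePrimes n \ S → r ∈ simplePrimes n := by
    intro r hr hd hnot
    rcases h.outer_of_dvd_two hr (by rwa [h15]) with h' | h' | h'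
    · exact absurd h' hr.not_dvd_one
    · exact h'
    · exact absurd h' hnot
  have m3 := key 3 (by norm_num) (by norm_num) fun h' => by
    have := h.bound_outer hn h'
    omega
  have m5 := key 5 (by norm_num) (by norm_num) fun h' => by
    have := h.bound_outer hn h'
    omega
  simpa using hsh.eq_of_mod m3 (by norm_num) m5

lemma localSigma_two_eq_three (hn : Admissible n) (h : IsCofactor n S ∅ d) :
    localSigma n 2 = 3 := by
  have h1 := localSigma_two (n := n)
  have h2 := hn.factorization_two_pos
  have hlt := h.mul_lt_sixteen hn
  have hle : localSigma n 2 ≤ localSigma n 2 * d := Nat.le_mul_of_pos_right _ h.pos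
  have h7 := h.localSigma_two_ne_seven hn
  have h15 := h.localSigma_two_ne_fifteen hn
  have h4 : n.factorization 2 < 4 := by
    by_contra hge
    have : 2 ^ 5 ≤ 2 ^ (n.factorization 2 + 1) := Nat.pow_le_pow_right (by norm_num) (by omega)
    omega
  interval_cases n.factorization 2 <;> omega

lemma eq_one_or_three (hn : Admissible n) (h : IsCofactor n S ∅ d) : d = 1 ∨ d = 3 := by
  have hlt := h.mul_lt_sixteen hn
  rw [h.localSigma_two_eq_three hn] at hlt
  obtain ⟨k, rfl⟩ := h.odd_cofactor hn
  have h5 := h.not_five_dvd hn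
  have : k ≠ 2 := by
    rintro rfl
    norm_num at h5
  omega

lemma three_notMem_simple (hn : Admissible n) (h : IsCofactor n S ∅ d) : 3 ∉ simplePrimes n := by
  intro h3
  have h2 := h.localSigma_two_eq_three hn
  have hE : simplePrimes n = {3} := Finset.eq_singleton_iff_unique_mem.2
    ⟨h3, fun x hx => (h.even_shape hn).1.eq_of_mod h3 (by norm_num) hx⟩
  have h3S : 3 ∉ doublePrimes n := Finset.disjoint_left.1 disjoint_simple_double h3
  have h3B : 3 ∉ highPrimes n := Finset.disjoint_left.1 disjoint_simple_high h3
  obtain rfl : d = 1 := by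
    refine (h.eq_one_or_three hn).resolve_right ?_
    rintro rfl
    rcases h.of_dvd Nat.prime_three dvd_rfl with h' | h' | h' | h'
    · omega
    · exact h3B h'
    · exact h3S (h.subset h')
    · simp at h'
  have hin := h.inner
  have hout := h.outer
  simp only [hE, Finset.prod_singleton, localSigma_of_simple h3, Finset.prod_empty, mul_one,
    Finset.sdiff_empty, h2, one_mul] at hin hout
  -- A prime of `S` divides `4 * ∏ σ(q ^ 2)`, so it is `≡ 1 (mod 3)`, which brings in the prime `3`.
  obtain rfl : S = ∅ := by
    refine Finset.eq_empty_of_forall_notMem fun q hq => ?_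
    have hp := prime_of_double (h.subset hq)
    have hd : q ∣ 4 * ∏ x ∈ S, localSigma n x := by
      rw [show 4 = 3 + 1 from rfl, hin]
      exact dvd_mul_of_dvd_right ((dvd_pow_self q two_ne_zero).trans
        (Finset.dvd_prod_of_mem (fun x => x ^ 2) hq)) _
    rcases (Nat.Prime.dvd_mul hp).1 hd with hd | hd
    · have : q ∣ 2 ^ 2 := hd
      exact (mem_double.1 (h.subset hq)).2.1
        ((Nat.prime_dvd_prime_iff_eq hp Nat.prime_two).1 (hp.dvd_of_dvd_pow this))
    · obtain ⟨y, hy, hqy⟩ := (Nat.Prime.prime hp).exists_mem_finset_dvd hd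
      rw [localSigma_of_double (h.subset hy)] at hqy
      rcases mod_three_of_dvd hp hqy with rfl | hq3
      · exact h3S (h.subset hq)
      · rcases h.inner_of_dvd_double Nat.prime_three hq (three_dvd_of_mod hq3) with h' | h' | h'
        · omega
        · exact h3B h'
        · exact h3S (h.subset h')
  have hB : highPrimes n = ∅ := by
    refine Finset.eq_empty_of_forall_notMem fun q hq => ?_
    have hd := Finset.dvd_prod_of_mem (fun x => x ^ 2) hq
    simp only [Finset.prod_empty, mul_one] at hin
    have h1 : ∏ x ∈ highPrimes n, x ^ 2 = 1 := by omega
    rw [h1, Nat.dvd_one] at hd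
    have := (prime_of_high hq).two_le
    nlinarith
  simp only [hB, Finset.sdiff_empty, Finset.prod_empty, mul_one] at hout
  have hmod : ∀ q ∈ doublePrimes n, q % 3 = 1 := by
    intro q hq
    have hp := prime_of_double hq
    have hd : q ∣ 3 * ∏ x ∈ doublePrimes n, localSigma n x := by
      rw [hout]
      exact dvd_mul_of_dvd_right ((dvd_pow_self q two_ne_zero).trans
        (Finset.dvd_prod_of_mem (fun x => x ^ 2) hq)) _
    have hq3 : q ≠ 3 := fun h => h3S (h ▸ hq)
    rcases (Nat.Prime.dvd_mul hp).1 hd with hd | hd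
    · exact absurd ((Nat.prime_dvd_prime_iff_eq hp Nat.prime_three).1 hd) hq3
    · obtain ⟨y, hy, hqy⟩ := (Nat.Prime.prime hp).exists_mem_finset_dvd hd
      rw [localSigma_of_double hy] at hqy
      exact (mod_three_of_dvd hp hqy).resolve_left hq3
  rcases (doublePrimes n).eq_empty_or_nonempty with hT | ⟨q, hq⟩
  · simp [hT] at hout
  · have hT : doublePrimes n = {q} := Finset.eq_singleton_iff_unique_mem.2 ⟨hq, fun y hy => by
      by_contra hne
      exact hn.false_of_one_mod_three hn.two_mem (by rw [h2]) hq hy (hmod q hq) (hmod y hy)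
        (mem_double.1 hq).2.1.symm (mem_double.1 hy).2.1.symm (Ne.symm hne)⟩
    rw [hT, Finset.prod_singleton, Finset.prod_singleton, localSigma_of_double hq] at hout
    have := (prime_of_double hq).two_le
    nlinarith

/-- If `d = 1`, then `3` is a double prime outside `S`, so `13 = (3 ^ 3 - 1) / 2` is simple or again
double outside `S`. Both cases are ruled out by following prime divisors further. -/
lemma ne_one (hn : Admissible n) (h : IsCofactor n S ∅ d) : d ≠ 1 := by
  rintro rfl
  have h2 := h.localSigma_two_eq_three hn
  have h3E := h.three_notMem_simple hn
  have hsh := (h.even_shape hn).1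
  have hout : ∀ {x r : ℕ}, r.Prime → x ∈ doublePrimes n \ S → r ∣ x ^ 2 + x + 1 →
      r ∈ simplePrimes n ∨ r ∈ doublePrimes n \ S := fun hr hx hd =>
    (h.outer_of_dvd_double hr hx hd).resolve_left hr.not_dvd_one
  have hout4 : ∀ {x r : ℕ}, r.Prime → x ∈ highPrimes n → r ∣ x ^ 4 + x ^ 3 + x ^ 2 + x + 1 →
      r ∈ simplePrimes n ∨ r ∈ doublePrimes n \ S := fun hr hx hd =>
    (h.outer_of_dvd_high hn hr hx hd).resolve_left hr.not_dvd_one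
  have m3 : 3 ∈ doublePrimes n \ S := by
    rcases h.outer_of_dvd_two Nat.prime_three (by rw [h2]) with h' | h' | h'
    · norm_num at h'
    · exact absurd h' h3E
    · exact h'
  have h3' : ¬ (3 = 2 ∨ 3 ∈ highPrimes n ∨ 3 ∈ S) := by
    rintro (h' | h' | h')
    · omega
    · exact Finset.disjoint_left.1 disjoint_double_high (Finset.mem_sdiff.1 m3).1 h'
    · exact (Finset.mem_sdiff.1 m3).2 h'
  -- As `3` is outside, no simple prime is `≡ 2` and no prime of `S` is `≡ 1 (mod 3)`.
  have hE3 : ∀ x ∈ simplePrimes n, ¬ 3 ∣ x + 1 := fun x hx hd =>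
    h3' (h.inner_of_dvd_simple Nat.prime_three hx hd)
  have hS3 : ∀ x ∈ S, ¬ 3 ∣ x ^ 2 + x + 1 := fun x hx hd =>
    h3' (h.inner_of_dvd_double Nat.prime_three hx hd)
  have hT3 : ∀ {x y : ℕ}, x ∈ doublePrimes n \ S → y ∈ doublePrimes n \ S → x ≠ y →
      x % 3 = 1 → y % 3 = 1 → False := fun hx hy hne hx3 hy3 => by
    have hx := (Finset.mem_sdiff.1 hx).1
    have hy := (Finset.mem_sdiff.1 hy).1
    exact hn.false_of_one_mod_three hn.two_mem (by rw [h2]) hx hy hx3 hy3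
        (mem_double.1 hx).2.1.symm (mem_double.1 hy).2.1.symm hne
  rcases hout (r := 13) (by norm_num) m3 (by norm_num) with m13 | m13
  · have m7 : 7 ∈ highPrimes n := by
      rcases h.inner_of_dvd_simple (r := 7) (by norm_num) m13 (by norm_num) with h' | h' | h'
      · omega
      · exact h'
      · exact absurd (by norm_num) (hS3 7 h')
    rcases hout4 (r := 2801) (by norm_num) m7 (by norm_num) with m | m
    · exact hE3 _ m (by norm_num)
    · -- `2801 ^ 2 + 2801 + 1 = 37 * 43 * 4933`
      have m43 : 43 ∈ doublePrimes n \ S := by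
        rcases hout (r := 43) (by norm_num) m (by norm_num) with h' | h'
        · have := hn.residue 43 h'
          have := hsh.eq_of_mod h' (by norm_num) m13
          omega
        · exact h'
      have m37 := (hout (r := 37) (by norm_num) m (by norm_num)).resolve_right
        fun h' => hT3 m43 h' (by norm_num) (by norm_num) (by norm_num)
      have m4933 := (hout (r := 4933) (by norm_num) m (by norm_num)).resolve_right
        fun h' => hT3 m43 h' (by norm_num) (by norm_num) (by norm_num)
      exact hsh.not_three m13 m37 m4933 (by norm_num) (by norm_num) (by norm_num)
  · have m61 := (hout (r := 61) (by norm_num) m13 (by norm_num)).resolve_right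
        fun h' => hT3 m13 h' (by norm_num) (by norm_num) (by norm_num)
    have m31 : 31 ∈ highPrimes n := by
      rcases h.inner_of_dvd_simple (r := 31) (by norm_num) m61 (by norm_num) with h' | h' | h'
      · omega
      · exact h'
      · exact absurd (by norm_num) (hS3 31 h')
    have m5 := (hout4 (r := 5) (by norm_num) m31 (by norm_num)).resolve_left
      fun h' => hE3 _ h' (by norm_num)
    rcases hout (r := 31) (by norm_num) m5 (by norm_num) with h' | h'
    · exact Finset.disjoint_left.1 disjoint_simple_high h' m31
    · exact Finset.disjoint_left.1 disjoint_double_high (Finset.mem_sdiff.1 h').1 m31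

lemma eq_empty_of_prod_le {R : Finset ℕ} (hR : R ⊆ doublePrimes n)
    (hle : ∏ x ∈ R, localSigma n x ≤ ∏ x ∈ R, x ^ 2) : R = ∅ := by
  by_contra hne
  refine absurd hle (not_le.2 (Finset.prod_lt_prod_of_nonempty
    (fun x hx => pow_pos (prime_of_double (hR hx)).pos 2) (fun x hx => ?_)
    (Finset.nonempty_iff_ne_empty.2 hne)))
  rw [localSigma_of_double (hR hx)]
  omega

/-- A closed set `S` exists only for `n = 1782`: here `d = 3`, so `3` is high and `σ(3 ^ 4) = 11 ^ 2`
forces `11` to be the only simple prime; then there is no room for another prime. -/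
lemma eq_1782 (hn : Admissible n) (h : IsCofactor n S ∅ d) : n = 1782 := by
  have h2 := h.localSigma_two_eq_three hn
  have h3E := h.three_notMem_simple hn
  have hsh := (h.even_shape hn).1
  obtain rfl : d = 3 := (h.eq_one_or_three hn).resolve_left (h.ne_one hn)
  have m3 : 3 ∈ highPrimes n := by
    rcases h.of_dvd Nat.prime_three dvd_rfl with h' | h' | h' | h'
    · omega
    · exact h'
    · have := h.bound_inner hn h'
      omega
    · simp at h'
  have s3 : localSigma n 3 = 121 := by
    rw [h.localSigma_high hn m3]
    norm_num
  have hout := h.outer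
  rw [h2, ← Finset.mul_prod_erase _ _ m3, s3, Finset.sdiff_empty] at hout
  have hT3 : 3 ∉ doublePrimes n := fun h' => Finset.disjoint_left.1 disjoint_double_high h' m3
  have m11 : 11 ∈ simplePrimes n := by
    rcases h.outer_of_dvd_high hn (r := 11) (by norm_num) m3 (by norm_num) with h' | h' | h'
    · norm_num at h'
    · exact h'
    · exfalso
      have m7 : 7 ∈ doublePrimes n \ S := by
        rcases h.outer_of_dvd_double (r := 7) (by norm_num) h' (by norm_num) with h' | h' | h'
        · norm_num at h'
        · have := hn.residue 7 h'
          omega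
        · exact h'
      -- The remaining factors of `σ(n)` are divisible by `9`, their product by `3` only.
      have h9 : 3 ∣ (∏ x ∈ simplePrimes n, x ^ 2) * ∏ x ∈ doublePrimes n \ S, x ^ 2 := by
        refine Nat.dvd_of_mul_dvd_mul_left (show 0 < 3 by norm_num) ?_
        rw [← mul_assoc, ← hout]
        refine mul_dvd_mul (Dvd.intro _ rfl) ?_
        refine Dvd.dvd.trans ?_ (Finset.dvd_prod_of_mem _ m7)
        rw [localSigma_of_double (Finset.mem_sdiff.1 m7).1]
        norm_num
      rcases (Nat.Prime.dvd_mul Nat.prime_three).1 h9 with h9 | h9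
      · obtain ⟨y, hy, hry⟩ := (Nat.Prime.prime Nat.prime_three).exists_mem_finset_dvd h9
        rw [← (Nat.prime_dvd_prime_iff_eq Nat.prime_three (prime_of_simple hy)).1
          (Nat.prime_three.dvd_of_dvd_pow hry)] at hy
        exact h3E hy
      · obtain ⟨y, hy, hry⟩ := (Nat.Prime.prime Nat.prime_three).exists_mem_finset_dvd h9
        have hy := (Finset.mem_sdiff.1 hy).1
        rw [← (Nat.prime_dvd_prime_iff_eq Nat.prime_three (prime_of_double hy)).1
          (Nat.prime_three.dvd_of_dvd_pow hry)] at hy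
        exact hT3 hy
  have hE : simplePrimes n = {11} := Finset.eq_singleton_iff_unique_mem.2
    ⟨m11, fun x hx => hsh.eq_of_mod m11 (by norm_num) hx⟩
  rw [hE, Finset.prod_singleton] at hout
  have hBpos : 0 < ∏ x ∈ (highPrimes n).erase 3, localSigma n x :=
    Finset.prod_pos fun x hx => localSigma_pos (prime_of_high (Finset.mem_of_mem_erase hx))
  have hout' : (∏ x ∈ (highPrimes n).erase 3, localSigma n x) *
      ∏ x ∈ doublePrimes n \ S, localSigma n x = ∏ x ∈ doublePrimes n \ S, x ^ 2 := by
    refine Nat.eq_of_mul_eq_mul_left (show 0 < 363 by norm_num) ?_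
    linarith
  have hT : doublePrimes n \ S = ∅ := eq_empty_of_prod_le Finset.sdiff_subset
    (hout' ▸ Nat.le_mul_of_pos_left _ hBpos)
  rw [hT, Finset.prod_empty, Finset.prod_empty, mul_one] at hout'
  have hB : highPrimes n = {3} := Finset.eq_singleton_iff_unique_mem.2 ⟨m3, fun x hx => by
    by_contra hne
    have hd := Finset.dvd_prod_of_mem (localSigma n) (Finset.mem_erase.2 ⟨hne, hx⟩)
    rw [hout', Nat.dvd_one, h.localSigma_high hn hx] at hd
    have := (prime_of_high hx).pos
    omega⟩
  have hin := h.inner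
  simp only [hE, hB, Finset.prod_singleton, localSigma_of_simple m11, Finset.prod_empty,
    mul_one] at hin
  have hS : S = ∅ := eq_empty_of_prod_le h.subset (by omega)
  have hD : doublePrimes n = ∅ := by rwa [hS, Finset.sdiff_empty] at hT
  have hn0 : n ≠ 0 := (Nat.mem_primeFactors.1 hn.two_mem).2.2
  have hf2 : n.factorization 2 = 1 := by
    have h1 := localSigma_two (n := n)
    rw [h2] at h1
    have := Nat.pow_right_injective (le_refl 2) (show 2 ^ 2 = 2 ^ (n.factorization 2 + 1) from h1)
    omega
  have hprod := hn.prod_split (fun x => x ^ n.factorization x) (Finset.empty_subset _)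
  rw [hE, hD, hB, Finset.sdiff_empty, Finset.prod_empty, Finset.prod_singleton,
    Finset.prod_singleton, hf2, h.factorization_high hn m3, (mem_simple.1 m11).2.2] at hprod
  have hself : ∏ x ∈ n.primeFactors, x ^ n.factorization x = n :=
    Nat.prod_factorization_pow_eq_self hn0
  rw [← hself, hprod]
  norm_num

end IsCofactor

end

/-! ### At most three generations of successors -/

section

variable {n : ℕ}

/-- The odd primes `q` with `q ^ 2 ∥ n` that divide `σ(x ^ e)` for some `x ∈ R` with `x ^ e ∥ n`. -/
def successors (n : ℕ) (R : Finset ℕ) : Finset ℕ :=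
  (doublePrimes n).filter fun q => ∃ x ∈ R, q ∣ localSigma n x

lemma mem_successors {R : Finset ℕ} {q : ℕ} :
    q ∈ successors n R ↔ q ∈ doublePrimes n ∧ ∃ x ∈ R, q ∣ localSigma n x := by
  simp [successors]

lemma successors_subset {R : Finset ℕ} : successors n R ⊆ doublePrimes n :=
  Finset.filter_subset _ _

/-- The argument against a path `q₁, a, 3, 13` of length four: `S` consists of the successors of
the simple primes and of `a`, and `3` is the only prime through which a divisor of a factor of
`σ(n)` can leave `S`. -/
lemma Admissible.false_of_closed_up_to_three (hn : Admissible n) {S : Finset ℕ} {a : ℕ}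
    (hS : S ⊆ doublePrimes n) (haS : a ∈ S) (ha : a % 3 = 1) (h3 : 3 ∈ doublePrimes n)
    (h3S : 3 ∉ S) (h13 : 13 ∈ doublePrimes n) (h13S : 13 ∉ S)
    (hcl : ∀ x ∈ simplePrimes n ∪ S, ∀ r, r.Prime → r ∣ localSigma n x →
      r = 2 ∨ r ∈ highPrimes n ∨ r ∈ S ∨ r ∈ ({3} : Finset ℕ)) : False := by
  obtain ⟨d, h⟩ := hn.exists_isCofactor hS (Finset.singleton_subset_iff.2 h3)
    (Finset.disjoint_singleton_right.2 h3S) hcl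
  have hmem3 : 3 ∈ doublePrimes n \ S := Finset.mem_sdiff.2 ⟨h3, h3S⟩
  have hmem13 : 13 ∈ doublePrimes n \ S := Finset.mem_sdiff.2 ⟨h13, h13S⟩
  have ha13 : a ≠ 13 := fun h' => h13S (h' ▸ haS)
  -- `3` divides both `σ(a ^ 2)` and `σ(13 ^ 2)`, hence not `σ(2 ^ e₀)`.
  have h32 : ¬ 3 ∣ localSigma n 2 := fun h' =>
    hn.false_of_one_mod_three hn.two_mem h' (hS haS) h13 ha (by norm_num)
      (mem_double.1 (hS haS)).2.1.symm (by norm_num) ha13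
  have h3d : 3 ∣ d := by
    rcases h.of_dvd_outer Nat.prime_three (Or.inr (Or.inr hmem13))
      (by rw [localSigma_of_double h13]; norm_num) with h' | h' | h'
    · exact h'
    · exact absurd h3 (Finset.disjoint_left.1 disjoint_simple_double h')
    · simp at h'
  have hb := h.bound_of_le le_rfl le_rfl
    (one_le_mul_of_one_le_of_one_le (IsCofactor.one_le_double h3) (IsCofactor.one_le_double h13))
    h.one_le_inner (IsCofactor.one_le_prod_high hn)
    (mul_le_prod_of_one_le (fun _ hx => IsCofactor.one_le_double (Finset.mem_sdiff.1 hx).1)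
      hmem3 hmem13 (by norm_num))
  rw [localSigma_of_double h3, localSigma_of_double h13, Finset.prod_singleton] at hb
  have hb' : localSigma n 2 * d ≤ 92 := by
    have : (localSigma n 2 * d : ℝ) < 93 := by
      norm_num at hb
      linarith
    have : localSigma n 2 * d < 93 := by exact_mod_cast this
    omega
  have hd3 := Nat.le_of_dvd h.pos h3d
  have h7 : localSigma n 2 = 7 := by
    have h1 := localSigma_two (n := n)
    have h2 := hn.factorization_two_pos
    have hle : localSigma n 2 * 3 ≤ localSigma n 2 * d := Nat.mul_le_mul_left _ hd3
    have h4 : n.factorization 2 < 4 := by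
      by_contra hge
      have : 2 ^ 5 ≤ 2 ^ (n.factorization 2 + 1) := Nat.pow_le_pow_right (by norm_num) (by omega)
      omega
    interval_cases n.factorization 2 <;> omega
  rw [h7] at hb'
  rcases h.of_dvd_outer (r := 7) (by norm_num) (Or.inl rfl) (by rw [h7]) with h' | h' | h'
  · have := Nat.le_of_dvd h.pos (Nat.Coprime.mul_dvd_of_dvd_of_dvd (by norm_num) h3d h')
    omega
  · have := hn.residue 7 h'
    omega
  · have h'' := (Finset.mem_sdiff.1 h').1
    have ha7 : a ≠ 7 := fun h => (Finset.mem_sdiff.1 h'').2 (h ▸ haS)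
    refine hn.false_of_one_mod_three (mem_double.1 (Finset.mem_sdiff.1 h'').1).1 ?_ (hS haS) h13 ha
      (by norm_num) ha7.symm (by norm_num) ha13
    rw [localSigma_of_double (Finset.mem_sdiff.1 h'').1]
    norm_num

/-- At most three generations of successors of the simple primes are needed to come back to a
simple prime. -/
theorem Admissible.exists_dvd (hn : Admissible n) (h1782 : n ≠ 1782) :
    ∃ p ∈ simplePrimes n, ∃ x ∈ simplePrimes n ∪ (successors n (simplePrimes n) ∪
      (successors n (successors n (simplePrimes n)) ∪
        successors n (successors n (successors n (simplePrimes n))))), p ∣ localSigma n x := by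
  by_contra! hno
  set R₁ := successors n (simplePrimes n) with hR₁
  set R₂ := successors n R₁ with hR₂
  set R₃ := successors n R₂ with hR₃
  have hsub : R₁ ∪ (R₂ ∪ R₃) ⊆ doublePrimes n :=
    Finset.union_subset successors_subset (Finset.union_subset successors_subset successors_subset)
  -- A prime divisor of a factor of `σ(n)` at one of these primes is `2`, high or a successor.
  have hnext : ∀ R, R ⊆ simplePrimes n ∪ (R₁ ∪ (R₂ ∪ R₃)) → ∀ x ∈ R, ∀ r, r.Prime →
      r ∣ localSigma n x → r = 2 ∨ r ∈ highPrimes n ∨ r ∈ successors n R := by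
    intro R hR x hx r hr hrx
    have hxn : x ∈ n.primeFactors := by
      rcases Finset.mem_union.1 (hR hx) with h | h
      · exact (mem_simple.1 h).1
      · exact (mem_double.1 (hsub h)).1
    rcases cases_mem (hn.mem_of_dvd hr hxn hrx) with h | h | h | h
    · exact Or.inl h
    · exact absurd hrx (hno r h x (hR hx))
    · exact Or.inr (Or.inr (mem_successors.2 ⟨h, x, hx, hrx⟩))
    · exact Or.inr (Or.inl h)
  have hsubE : simplePrimes n ⊆ simplePrimes n ∪ (R₁ ∪ (R₂ ∪ R₃)) := by grind
  have hsub1 : R₁ ⊆ simplePrimes n ∪ (R₁ ∪ (R₂ ∪ R₃)) := by grind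
  have hsub2 : R₂ ⊆ simplePrimes n ∪ (R₁ ∪ (R₂ ∪ R₃)) := by grind
  have hsub3 : R₃ ⊆ simplePrimes n ∪ (R₁ ∪ (R₂ ∪ R₃)) := by grind
  by_cases hcl : successors n R₃ ⊆ R₁ ∪ (R₂ ∪ R₃)
  · obtain ⟨d, hd⟩ := hn.exists_isCofactor hsub (Finset.empty_subset _)
      (Finset.disjoint_empty_right _) (fun x hx r hr hrx => by
        have key : r = 2 ∨ r ∈ highPrimes n ∨ r ∈ R₁ ∪ (R₂ ∪ R₃) := by
          simp only [Finset.mem_union] at hx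
          rcases hx with hx | hx | hx | hx
          · have := hnext _ hsubE x hx r hr hrx
            grind
          · have := hnext _ hsub1 x hx r hr hrx
            grind
          · have := hnext _ hsub2 x hx r hr hrx
            grind
          · have := hnext _ hsub3 x hx r hr hrx
            grind
        tauto)
    exact h1782 (hd.eq_1782 hn)
  obtain ⟨q₄, hq₄, hq₄n⟩ := Finset.not_subset.1 hcl
  simp only [Finset.mem_union, not_or] at hq₄n
  obtain ⟨hd₄, q₃, hq₃, h34⟩ := mem_successors.1 hq₄
  obtain ⟨hd₃, q₂, hq₂, h23⟩ := mem_successors.1 hq₃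
  obtain ⟨hd₂, q₁, hq₁, h12⟩ := mem_successors.1 hq₂
  have hd₁ := successors_subset hq₁
  have h3₂ : q₃ ∉ R₂ := fun h => hq₄n.2.2 (mem_successors.2 ⟨hd₄, q₃, h, h34⟩)
  have h3₁ : q₃ ∉ R₁ := fun h => hq₄n.2.1 (mem_successors.2 ⟨hd₄, q₃, h, h34⟩)
  have h2₁ : q₂ ∉ R₁ := fun h => h3₂ (mem_successors.2 ⟨hd₃, q₂, h, h23⟩)
  have hne12 : q₁ ≠ q₂ := fun h => h2₁ (h ▸ hq₁)
  have hne13 : q₁ ≠ q₃ := fun h => h3₁ (h ▸ hq₁)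
  have hne14 : q₁ ≠ q₄ := fun h => hq₄n.1 (h ▸ hq₁)
  have hne23 : q₂ ≠ q₃ := fun h => h3₂ (h ▸ hq₂)
  have hne24 : q₂ ≠ q₄ := fun h => hq₄n.2.1 (h ▸ hq₂)
  have hne34 : q₃ ≠ q₄ := fun h => hq₄n.2.2 (h ▸ hq₃)
  have hmod : ∀ {x y : ℕ}, x ∈ doublePrimes n → y ∈ doublePrimes n → y ∣ localSigma n x →
      y = 3 ∨ y % 3 = 1 := fun {x y} hx hy hd => by
    rw [localSigma_of_double hx] at hd
    exact mod_three_of_dvd (prime_of_double hy) hd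
  have hthree : ∀ x ∈ doublePrimes n, ∀ y ∈ doublePrimes n, ∀ z ∈ doublePrimes n,
      x % 3 = 1 → y % 3 = 1 → z % 3 = 1 → x ≠ y → x ≠ z → y ≠ z → False := by
    intro x hx y hy z hz hx3 hy3 hz3 hxy hxz hyz
    refine hn.false_of_one_mod_three (mem_double.1 hx).1 ?_ hy hz hy3 hz3 hxy hxz hyz
    rw [localSigma_of_double hx]
    exact three_dvd_of_mod hx3
  have m₂ := hmod hd₁ hd₂ h12
  have m₃ := hmod hd₂ hd₃ h23
  have m₄ := hmod hd₃ hd₄ h34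
  have h3of : ∀ {x : ℕ}, x ∈ doublePrimes n → x % 3 = 1 → 3 ∣ localSigma n x := fun hx h => by
    rw [localSigma_of_double hx]
    exact three_dvd_of_mod h
  -- `3` is among the last three primes, the other two are `≡ 1 (mod 3)`, so `q₁ ≡ 2 (mod 3)`.
  have hq₁3 : q₁ % 3 ≠ 1 := by
    intro h
    rcases m₂ with m₂ | m₂ <;> rcases m₃ with m₃ | m₃ <;> rcases m₄ with m₄ | m₄
    · omega
    · omega
    · omega
    · exact hthree _ hd₁ _ hd₃ _ hd₄ h m₃ m₄ hne13 hne14 hne34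
    · omega
    · exact hthree _ hd₁ _ hd₂ _ hd₄ h m₂ m₄ hne12 hne14 hne24
    · exact hthree _ hd₁ _ hd₂ _ hd₃ h m₂ m₃ hne12 hne13 hne23
    · exact hthree _ hd₂ _ hd₃ _ hd₄ m₂ m₃ m₄ hne23 hne24 hne34
  have hq₂3 : q₂ % 3 = 1 := by
    refine m₂.resolve_left ?_
    rintro rfl
    rw [localSigma_of_double hd₁] at h12
    exact hq₁3 (mod_of_three_dvd h12)
  obtain rfl : q₃ = 3 := by
    refine m₃.resolve_right fun h => ?_
    rcases m₄ with rfl | m₄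
    · exact hq₄n.2.2 (mem_successors.2 ⟨hd₄, q₂, hq₂, h3of hd₂ hq₂3⟩)
    · exact hthree _ hd₂ _ hd₃ _ hd₄ hq₂3 h m₄ hne23 hne24 hne34
  obtain rfl : q₄ = 13 := by
    rw [localSigma_of_double hd₃] at h34
    exact (Nat.prime_dvd_prime_iff_eq (prime_of_double hd₄) (by norm_num)).1 h34
  have honly : ∀ y ∈ doublePrimes n, y % 3 = 1 → y = q₂ ∨ y = 13 := by
    intro y hy hy3
    by_contra! hne
    exact hthree _ hy _ hd₂ _ hd₄ hy3 hq₂3 (by norm_num) hne.1 hne.2 hne24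
  refine hn.false_of_closed_up_to_three (S := insert q₂ R₁) (a := q₂)
    (Finset.insert_subset hd₂ successors_subset) (Finset.mem_insert_self _ _) hq₂3 hd₃ ?_ hd₄ ?_ ?_
  · rw [Finset.mem_insert, not_or]
    exact ⟨hne23.symm, h3₁⟩
  · rw [Finset.mem_insert, not_or]
    exact ⟨hne24.symm, hq₄n.1⟩
  · intro x hx r hr hrx
    rw [Finset.mem_union, Finset.mem_insert] at hx
    rw [Finset.mem_insert, Finset.mem_singleton]
    rcases hx with hx | rfl | hx
    · exact (hnext _ hsubE x hx r hr hrx).imp_right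
        (Or.imp_right fun h => Or.inl (Or.inr h))
    · rcases hnext _ hsub2 x hq₂ r hr hrx with h | h | h
      · exact Or.inl h
      · exact Or.inr (Or.inl h)
      · have hdr := successors_subset h
        rcases hmod hd₂ hdr hrx with h3 | h3
        · exact Or.inr (Or.inr (Or.inr h3))
        · rcases honly r hdr h3 with h' | rfl
          · exact Or.inr (Or.inr (Or.inl (Or.inl h')))
          · exact absurd h hq₄n.2.2
    · rcases hnext _ hsub1 x hx r hr hrx with h | h | h
      · exact Or.inl h
      · exact Or.inr (Or.inl h)
      · have hdr := successors_subset h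
        rcases hmod (successors_subset hx) hdr hrx with rfl | h3
        · exact absurd h h3₂
        · rcases honly r hdr h3 with h' | rfl
          · exact Or.inr (Or.inr (Or.inl (Or.inl h')))
          · exact absurd h hq₄n.2.1

end

/-! ### The special form and the path -/

variable {n : ℕ}

/-- The prime factorization encoded in a product of powers of `2` and of distinct odd primes. -/
lemma factorization_of_eq_prod {s : ℕ} {p e : ℕ → ℕ}
    (h : n = 2 ^ e 0 * ∏ i ∈ Finset.Icc 1 s, p i ^ e i)
    (hp : ∀ i ∈ Finset.Icc 1 s, (p i).Prime ∧ Odd (p i) ∧ 0 < e i)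
    (hinj : ∀ i ∈ Finset.Icc 1 s, ∀ j ∈ Finset.Icc 1 s, p i = p j → i = j) :
    n ≠ 0 ∧
      (∀ j ∈ Finset.Icc 1 s, p j ∈ n.primeFactors ∧ p j ≠ 2 ∧ n.factorization (p j) = e j) ∧
      ∀ x ∈ n.primeFactors, x ≠ 2 → ∃ j ∈ Finset.Icc 1 s, x = p j := by
  have hne : ∀ i ∈ Finset.Icc 1 s, p i ^ e i ≠ 0 := fun i hi => pow_ne_zero _ (hp i hi).1.ne_zero
  have h0 : n ≠ 0 := by
    rw [h]
    exact mul_ne_zero (pow_ne_zero _ two_ne_zero) (Finset.prod_ne_zero_iff.2 hne)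
  have h2 : ∀ j ∈ Finset.Icc 1 s, p j ≠ 2 := by
    intro j hj hj2
    have := (hp j hj).2.1
    rw [hj2] at this
    exact absurd this (by decide)
  refine ⟨h0, fun j hj => ?_, fun x hx hx2 => ?_⟩
  · have hf : n.factorization (p j) = e j := by
      rw [h, Nat.factorization_mul (pow_ne_zero _ two_ne_zero) (Finset.prod_ne_zero_iff.2 hne),
        Nat.factorization_prod hne, Nat.prime_two.factorization_pow, Finsupp.add_apply,
        Finsupp.single_eq_of_ne (h2 j hj), zero_add, Finsupp.finsetSum_apply,
        Finset.sum_eq_single j]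
      · rw [(hp j hj).1.factorization_pow, Finsupp.single_eq_same]
      · intro i hi hij
        rw [(hp i hi).1.factorization_pow, Finsupp.single_eq_of_ne]
        exact fun heq => hij (hinj i hi j hj heq.symm)
      · exact fun hj' => absurd hj hj'
    refine ⟨?_, h2 j hj, hf⟩
    refine Nat.mem_primeFactors.2 ⟨(hp j hj).1, Nat.dvd_of_factorization_pos ?_, h0⟩
    rw [hf]
    exact (hp j hj).2.2.ne'
  · have hxp := Nat.prime_of_mem_primeFactors hx
    have hxn := Nat.dvd_of_mem_primeFactors hx
    rw [h] at hxn
    rcases (Nat.Prime.dvd_mul hxp).1 hxn with hd | hd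
    · exact absurd ((Nat.prime_dvd_prime_iff_eq hxp Nat.prime_two).1 (hxp.dvd_of_dvd_pow hd)) hx2
    · obtain ⟨j, hj, hxj⟩ := (Nat.Prime.prime hxp).exists_mem_finset_dvd hd
      exact ⟨j, hj, (Nat.prime_dvd_prime_iff_eq hxp (hp j hj).1).1 (hxp.dvd_of_dvd_pow hxj)⟩

theorem admissible_of_hasSpecialForm (hform : HasSpecialForm n)
    (hsigma : ArithmeticFunction.sigma 1 n = UniqueFactorizationMonoid.radical n ^ 2) :
    Admissible n := by
  obtain ⟨s, p, e, h, hp, hinj, hcase⟩ := hform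
  obtain ⟨hn0, hmem, hex⟩ := factorization_of_eq_prod h hp hinj
  have hprod : ∏ x ∈ n.primeFactors, localSigma n x = (∏ x ∈ n.primeFactors, x) ^ 2 := by
    rw [Nat.radical_eq_prod_primeFactors,
      ArithmeticFunction.isMultiplicative_sigma.multiplicative_factorization _ hn0] at hsigma
    exact hsigma
  have hsimple : ∀ j ∈ Finset.Icc 1 s, e j = 1 → p j ∈ simplePrimes n := fun j hj hej => by
    rw [mem_simple, (hmem j hj).2.2]
    exact ⟨(hmem j hj).1, (hmem j hj).2.1, hej⟩
  have hsimple' : ∀ x ∈ simplePrimes n, ∃ j ∈ Finset.Icc 1 s, e j = 1 ∧ x = p j := fun x hx => by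
    obtain ⟨hx1, hx2, hx3⟩ := mem_simple.1 hx
    obtain ⟨j, hj, rfl⟩ := hex x hx1 hx2
    exact ⟨j, hj, (hmem j hj).2.2 ▸ hx3, rfl⟩
  have hhigh' : ∀ x ∈ highPrimes n,
      ∃ j ∈ Finset.Icc 1 s, 3 ≤ e j ∧ n.factorization x = e j := fun x hx => by
    obtain ⟨hx1, hx2, hx3⟩ := mem_high.1 hx
    obtain ⟨j, hj, rfl⟩ := hex x hx1 hx2
    exact ⟨j, hj, (hmem j hj).2.2 ▸ hx3, (hmem j hj).2.2⟩
  -- `p + 1` is even and divides `σ(n)` for a simple prime `p`.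
  have htwo : ∀ x ∈ simplePrimes n, 2 ∈ n.primeFactors := fun x hx => by
    have hx' := (mem_simple.1 hx)
    have hodd := (prime_of_simple hx).eq_two_or_odd'.resolve_left hx'.2.1
    have h2 : 2 ∣ localSigma n x := by
      rw [localSigma_of_simple hx]
      exact hodd.add_one.two_dvd
    have h1 : 2 ∣ (∏ x ∈ n.primeFactors, x) ^ 2 :=
      hprod ▸ h2.trans (Finset.dvd_prod_of_mem _ hx'.1)
    obtain ⟨y, hy, hry⟩ :=
      (Nat.Prime.prime Nat.prime_two).exists_mem_finset_dvd (Nat.prime_two.dvd_of_dvd_pow h1)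
    rwa [(Nat.prime_dvd_prime_iff_eq Nat.prime_two (Nat.prime_of_mem_primeFactors hy)).1 hry]
  rcases hcase with ⟨hs, hp1, he1, heven⟩ | ⟨hs, hp1, hp2, he1, he2, hmin, heven⟩
  · have h1s : 1 ∈ Finset.Icc 1 s := Finset.mem_Icc.2 ⟨le_rfl, hs⟩
    have hidx : ∀ j ∈ Finset.Icc 1 s, j = 1 ∨ Even (e j) := fun j hj => by
      rw [Finset.mem_Icc] at hj
      by_cases hj1 : j = 1
      · exact Or.inl hj1
      · exact Or.inr (heven j (Finset.mem_Icc.2 ⟨by omega, hj.2⟩))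
    have hE : ∀ x ∈ simplePrimes n, x = p 1 := fun x hx => by
      obtain ⟨j, hj, hej, rfl⟩ := hsimple' x hx
      rcases hidx j hj with rfl | hev
      · rfl
      · simp [hej] at hev
    have hB : ∀ x ∈ highPrimes n, Even (n.factorization x) := fun x hx => by
      obtain ⟨j, hj, hej, hf⟩ := hhigh' x hx
      rcases hidx j hj with rfl | hev
      · omega
      · exact hf ▸ hev
    refine ⟨hprod, htwo _ (hsimple 1 h1s he1), fun x hx => ?_, fun x hx => ?_, Or.inl ⟨p 1, ?_, hp1,
      hB⟩⟩
    · have h3 := (mem_high.1 hx).2.2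
      obtain ⟨k, hk⟩ := hB x hx
      omega
    · rw [hE x hx]
      exact Or.inr hp1
    · exact Finset.eq_singleton_iff_unique_mem.2 ⟨hsimple 1 h1s he1, hE⟩
  · have h1s : 1 ∈ Finset.Icc 1 s := Finset.mem_Icc.2 ⟨le_rfl, by omega⟩
    have h2s : 2 ∈ Finset.Icc 1 s := Finset.mem_Icc.2 ⟨by omega, hs⟩
    have hp1' : p 1 % 4 = 1 := hp1
    have hp2' : p 2 % 4 = 1 := hp2
    have he1' : e 1 % 4 = 1 := he1
    have he2' : e 2 % 4 = 1 := he2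
    have hne : p 1 ≠ p 2 := fun heq => by simpa using hinj 1 h1s 2 h2s heq
    have hidx : ∀ j ∈ Finset.Icc 1 s, j = 1 ∨ j = 2 ∨ Even (e j) := fun j hj => by
      rw [Finset.mem_Icc] at hj
      by_cases hj1 : j = 1
      · exact Or.inl hj1
      by_cases hj2 : j = 2
      · exact Or.inr (Or.inl hj2)
      · exact Or.inr (Or.inr (heven j (Finset.mem_Icc.2 ⟨by omega, hj.2⟩)))
    have hE : ∀ x ∈ simplePrimes n, x = p 1 ∧ e 1 = 1 ∨ x = p 2 ∧ e 2 = 1 := fun x hx => by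
      obtain ⟨j, hj, hej, rfl⟩ := hsimple' x hx
      rcases hidx j hj with rfl | rfl | hev
      · exact Or.inl ⟨rfl, hej⟩
      · exact Or.inr ⟨rfl, hej⟩
      · simp [hej] at hev
    have hhigh : ∀ j ∈ Finset.Icc 1 s, 3 ≤ e j → p j ∈ highPrimes n := fun j hj hej => by
      rw [mem_high, (hmem j hj).2.2]
      exact ⟨(hmem j hj).1, (hmem j hj).2.1, hej⟩
    have hge : ∀ j ∈ Finset.Icc 1 s, p j % 4 = 1 → 5 ≤ p j := fun j hj hj4 => by
      have := (hp j hj).1.two_le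
      omega
    have hminor : e 1 = 1 ∨ e 2 = 1 := by omega
    refine ⟨hprod, ?_, fun x hx => ?_, fun x hx => ?_, Or.inr ?_⟩
    · rcases hminor with h1 | h1
      · exact htwo _ (hsimple 1 h1s h1)
      · exact htwo _ (hsimple 2 h2s h1)
    · obtain ⟨j, hj, hej, hf⟩ := hhigh' x hx
      rw [hf]
      rcases hidx j hj with rfl | rfl | ⟨k, hk⟩ <;> omega
    · rcases hE x hx with ⟨rfl, _⟩ | ⟨rfl, _⟩ <;> omega
    · by_cases h1 : e 1 = 1
      · by_cases h2 : e 2 = 1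
        · refine Or.inl ⟨p 1, p 2, hne, ?_, hp1', hp2', fun x hx => ?_⟩
          · ext x
            rw [Finset.mem_insert, Finset.mem_singleton]
            constructor
            · intro hx
              have := hE x hx
              tauto
            · rintro (rfl | rfl)
              · exact hsimple 1 h1s h1
              · exact hsimple 2 h2s h2
          · obtain ⟨j, hj, hej, hf⟩ := hhigh' x hx
            rw [hf]
            rcases hidx j hj with rfl | rfl | hev
            · omega
            · omega
            · exact hev
        · refine Or.inr ⟨p 1, p 2, ?_, hhigh 2 h2s (by omega), hge 2 h2s hp2', ?_⟩
          · refine Finset.eq_singleton_iff_unique_mem.2 ⟨hsimple 1 h1s h1, fun x hx => ?_⟩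
            have := hE x hx
            tauto
          · rw [(hmem 2 h2s).2.2]
            omega
      · refine Or.inr ⟨p 2, p 1, ?_, hhigh 1 h1s (by omega), hge 1 h1s hp1', ?_⟩
        · refine Finset.eq_singleton_iff_unique_mem.2
            ⟨hsimple 2 h2s (hminor.resolve_left h1), fun x hx => ?_⟩
          have := hE x hx
          tauto
        · rw [(hmem 1 h1s).2.2]
          omega

lemma exactlyDivides_factorization {x : ℕ} (hx : x ∈ n.primeFactors) :
    ExactlyDivides x (n.factorization x) n :=
  ⟨Nat.ordProj_dvd n x, Nat.pow_succ_factorization_not_dvd (Nat.mem_primeFactors.1 hx).2.2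
    (Nat.prime_of_mem_primeFactors hx)⟩

lemma exactlyDivides_of_simple {x : ℕ} (hx : x ∈ simplePrimes n) : ExactlyDivides x 1 n :=
  (mem_simple.1 hx).2.2 ▸ exactlyDivides_factorization (mem_simple.1 hx).1

lemma exactlyDivides_of_double {x : ℕ} (hx : x ∈ doublePrimes n) : ExactlyDivides x 2 n :=
  (mem_double.1 hx).2.2 ▸ exactlyDivides_factorization (mem_double.1 hx).1

lemma odd_of_simple {x : ℕ} (hx : x ∈ simplePrimes n) : Odd x :=
  (prime_of_simple hx).eq_two_or_odd'.resolve_left (mem_simple.1 hx).2.1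

lemma dvd_sigma_of_simple {x r : ℕ} (hx : x ∈ simplePrimes n) (h : r ∣ localSigma n x) :
    r ∣ ArithmeticFunction.sigma 1 x := by
  rwa [localSigma, (mem_simple.1 hx).2.2, pow_one] at h

lemma dvd_sigma_of_double {x r : ℕ} (hx : x ∈ doublePrimes n) (h : r ∣ localSigma n x) :
    r ∣ ArithmeticFunction.sigma 1 (x ^ 2) := by
  rwa [localSigma, (mem_double.1 hx).2.2] at h

/-- The path promised by `Admissible.exists_dvd`, taken through the earliest generation of successors
that contains its last vertex, to make the `q i` distinct. -/
theorem Admissible.exists_path (hn : Admissible n) (h1782 : n ≠ 1782) :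
    ∃ p ∈ simplePrimes n, ∃ p' ∈ simplePrimes n, ∃ (k : ℕ) (q : ℕ → ℕ), k ≤ 3 ∧
      (∀ i ∈ Finset.Icc 1 k, q i ∈ doublePrimes n) ∧
      (∀ i ∈ Finset.Icc 1 k, ∀ j ∈ Finset.Icc 1 k, q i = q j → i = j) ∧
      (k = 0 → p' ∣ localSigma n p) ∧
      (1 ≤ k → q 1 ∣ localSigma n p ∧
        (∀ i : ℕ, 1 ≤ i → i < k → q (i + 1) ∣ localSigma n (q i)) ∧ p' ∣ localSigma n (q k)) := by
  obtain ⟨p', hp', x, hx, hd⟩ := hn.exists_dvd h1782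
  by_cases hE : x ∈ simplePrimes n
  · exact ⟨x, hE, p', hp', 0, fun _ => x, by norm_num, by simp, by simp, fun _ => hd, by simp⟩
  by_cases hx₁ : x ∈ successors n (simplePrimes n)
  · obtain ⟨hxd, p, hp, hpx⟩ := mem_successors.1 hx₁
    refine ⟨p, hp, p', hp', 1, fun _ => x, by norm_num, fun _ _ => hxd, ?_, by simp, fun _ =>
      ⟨hpx, by omega, hd⟩⟩
    intro i hi j hj _
    rw [Finset.mem_Icc] at hi hj
    omega
  by_cases hx₂ : x ∈ successors n (successors n (simplePrimes n))
  · obtain ⟨hxd, q₁, hq₁, hq₁x⟩ := mem_successors.1 hx₂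
    obtain ⟨hq₁d, p, hp, hpq₁⟩ := mem_successors.1 hq₁
    have hne : q₁ ≠ x := fun h => hx₁ (h ▸ hq₁)
    refine ⟨p, hp, p', hp', 2, fun i => if i = 1 then q₁ else x, by norm_num, fun i _ => ?_, ?_,
      by simp, fun _ => ⟨by simpa using hpq₁, fun i hi hi2 => ?_, by simpa using hd⟩⟩
    · dsimp only
      split_ifs <;> assumption
    · intro i hi j hj
      rw [Finset.mem_Icc] at hi hj
      dsimp only
      split_ifs <;> omega
    · obtain rfl : i = 1 := by omega
      simpa using hq₁x
  · -- As `x` lies in no earlier generation, neither does `q₂`, so the path has distinct primes.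
    have hx₃ : x ∈ successors n (successors n (successors n (simplePrimes n))) := by
      simp only [Finset.mem_union] at hx
      tauto
    obtain ⟨hxd, q₂, hq₂, hq₂x⟩ := mem_successors.1 hx₃
    obtain ⟨hq₂d, q₁, hq₁, hq₁q₂⟩ := mem_successors.1 hq₂
    obtain ⟨hq₁d, p, hp, hpq₁⟩ := mem_successors.1 hq₁
    have hne1 : q₁ ≠ x := fun h => hx₁ (h ▸ hq₁)
    have hne2 : q₂ ≠ x := fun h => hx₂ (h ▸ hq₂)
    have hne12 : q₁ ≠ q₂ := fun h =>
      hx₂ (mem_successors.2 ⟨hxd, q₂, h ▸ hq₁, hq₂x⟩)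
    refine ⟨p, hp, p', hp', 3, fun i => if i = 1 then q₁ else if i = 2 then q₂ else x,
      by norm_num, fun i _ => ?_, ?_, by simp, fun _ => ⟨by simpa using hpq₁,
        fun i hi hi2 => ?_, by simpa using hd⟩⟩
    · dsimp only
      split_ifs <;> assumption
    · intro i hi j hj
      rw [Finset.mem_Icc] at hi hj
      dsimp only
      split_ifs <;> omega
    · obtain rfl | rfl : i = 1 ∨ i = 2 := by omega
      · simpa using hq₁q₂
      · simpa using hq₂x

end SigmaRadical

theorem theorem1p1 (n : ℕ) (hn1 : n ≠ 1) (hn2 : n ≠ 1782)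
    (hform : HasSpecialForm n)
    (hsigma : ArithmeticFunction.sigma 1 n = UniqueFactorizationMonoid.radical n ^ 2) :
    ∃ p p' : ℕ,
      p.Prime ∧ Odd p ∧ ExactlyDivides p 1 n ∧
      p'.Prime ∧ Odd p' ∧ ExactlyDivides p' 1 n ∧
      ∃ (k : ℕ) (q : ℕ → ℕ), k ≤ 3 ∧
        (∀ i ∈ Finset.Icc 1 k, (q i).Prime ∧ ExactlyDivides (q i) 2 n) ∧
        (∀ i ∈ Finset.Icc 1 k, ∀ j ∈ Finset.Icc 1 k, q i = q j → i = j) ∧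
        (k = 0 → p' ∣ ArithmeticFunction.sigma 1 p) ∧
        (1 ≤ k →
          q 1 ∣ ArithmeticFunction.sigma 1 p ∧
          (∀ i : ℕ, 1 ≤ i → i < k → q (i + 1) ∣ ArithmeticFunction.sigma 1 (q i ^ 2)) ∧
          p' ∣ ArithmeticFunction.sigma 1 (q k ^ 2)) := by
  obtain ⟨p, hp, p', hp', k, q, hk, hq, hinj, h0, h1⟩ :=
    (SigmaRadical.admissible_of_hasSpecialForm hform hsigma).exists_path hn2
  refine ⟨p, p', SigmaRadical.prime_of_simple hp, SigmaRadical.odd_of_simple hp,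
    SigmaRadical.exactlyDivides_of_simple hp, SigmaRadical.prime_of_simple hp',
    SigmaRadical.odd_of_simple hp', SigmaRadical.exactlyDivides_of_simple hp', k, q, hk,
    fun i hi => ⟨SigmaRadical.prime_of_double (hq i hi),
      SigmaRadical.exactlyDivides_of_double (hq i hi)⟩, hinj,
    fun h => SigmaRadical.dvd_sigma_of_simple hp (h0 h), fun h =>
      ⟨SigmaRadical.dvd_sigma_of_simple hp (h1 h).1, fun i hi hik => ?_, ?_⟩⟩
  · exact SigmaRadical.dvd_sigma_of_double (hq i (Finset.mem_Icc.2 ⟨hi, hik.le⟩))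
      ((h1 h).2.1 i hi hik)
  · exact SigmaRadical.dvd_sigma_of_double (hq k (Finset.mem_Icc.2 ⟨h, le_rfl⟩)) (h1 h).2.2
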